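/- Let $c_k>0$, $0<\gamma_1<\gamma_2<\cdots$, $\gamma_k\to+\infty$, let $1\le a_1\le a_2\le\cdots$, $a_n\to+\infty$ (the eigenvalues, counted with multiplicity, of a positive self-adjoint operator $A$ with compact inverse in a separable Hilbert space), and let $\theta\in[0,1]$. For $n\in\mathbb N$ consider the meromorphic function $$\ell_n(\lambda)=\lambda^2+a_n^2\Bigl(1-\frac1{a_n^{2(1-\theta)}}\sum_{k=1}^\infty\frac{c_k}{\lambda+\gamma_k}\Bigr).$$ Suppose that $\sum_{k=1}^\infty c_k/\gamma_k<1$ and that, as $k\to\infty$, $$c_k=\frac{\mathcal A}{k^\alpha}+O\Bigl(\frac1{k^{\alpha+1}}\Bigr),\qquad \gamma_k=\mathcal B k^\beta+O(k^{\beta-1}),$$ where $\mathcal A,\mathcal B>0$, $0<\alpha\le1$, $\alpha+\beta>1$ and $\beta>1/2$. Put $r=\frac{\alpha+\beta-1}{\beta}\in(0,1]$, $n_1=r+2(\tfrac12-\theta)$, $n_2=\min\{2(1-\theta),\,2r+3-4\theta\}$ and, for $0<r<1$, $$D_1=-\frac\pi2\,\frac{\cos(\frac\pi2(r+1))}{\sin(\pi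 r)}>0,\qquad D_2=-\frac\pi2\,\frac{\sin(\frac\pi2(r+1))}{\sin(\pi r)}<0 .$$ Then there are real numbers $\lambda_{n,k}$ and complex numbers $\lambda_n^{\pm}$ ($n,k\in\mathbb N$) such that: 1. for every $n$, the set of zeros of $\ell_n$ is $\{\lambda_{n,k}:k\in\mathbb N\}\cup\{\lambda_n^+,\lambda_n^-\}$; 2. for every $n$, $\cdots<-\gamma_{k+1}<\lambda_{n,k+1}<-\gamma_k<\lambda_{n,k}<\cdots<-\gamma_1<\lambda_{n,1}<0$; moreover, if $\theta<1$, then $\lim_{n\to\infty}\lambda_{n,k}=-\gamma_k$ for every $k$; 3. for all sufficiently large $n$ the zeros $\lambda_n^{\pm}$ are non-real and $\lambda_n^+=\overline{\lambda_n^-}$; 4. as $n\to\infty$, $$\lambda_n^\pm=-\frac{\mathcal A D_1\mathcal B^{r-1}}{\beta a_n^{n_1}}\pm i\Bigl(a_n+\frac{\mathcal A D_2\mathcal B^{r-1}}{\beta a_n^{n_1}}\Bigr)+O\Bigl(\frac1{a_n^{n_2}}\Bigr)\quad\text{if }0<r<\tfrac12\text{ and }\theta\ge\tfrac12,$$ $$\lambda_n^\pm=-\frac{\mathcal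 A D_1\mathcal B^{r-1}}{\beta a_n^{n_1}}\pm i\Bigl(a_n+\frac{\mathcal A D_2\mathcal B^{r-1}}{\beta a_n^{n_1}}\Bigr)+O\Bigl(\frac1{a_n^{2(1-\theta)}}\Bigr)\quad\text{if }0<r<1\text{ and }\bigl(r\ge\tfrac12\text{ or }\theta<\tfrac12\bigr),$$ $$\lambda_n^\pm=-\frac12\,\frac{\mathcal A}{\beta}\,\frac{\ln a_n}{a_n^{2(1-\theta)}}\pm i a_n+O\Bigl(\frac1{a_n^{2(1-\theta)}}\Bigr)\quad\text{if }r=1 .$$ -/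

import Mathlib

open Filter Topology Asymptotics

noncomputable section

namespace GurtinPipkin

/-!
Sequences that are indexed by `1, 2, 3, …` on paper are indexed by `0, 1, 2, …` here:
`c k`, `γ k`, `a n` stand for `c_{k+1}`, `γ_{k+1}`, `a_{n+1}`.
-/

/-- Standing assumptions on the coefficients and exponents of the kernel
`K(t) = ∑ c_k exp (-γ_k t)`: `c_k > 0`, `0 < γ_1 < γ_2 < …` and `γ_k → ∞`. -/
structure IsExpKernel (c γ : ℕ → ℝ) : Prop where
  c_pos : ∀ k, 0 < c k
  γ_pos : ∀ k, 0 < γ k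
  γ_strictMono : StrictMono γ
  γ_tendsto : Tendsto γ atTop atTop

/-- The condition `∑ c_k / γ_k < 1` (convergence of the series included). -/
def ConditionA (c γ : ℕ → ℝ) : Prop :=
  Summable (fun k => c k / γ k) ∧ ∑' k, c k / γ k < 1

/-- `c_k = 𝒜 k^{-α} + O(k^{-α-1})` and `γ_k = ℬ k^β + O(k^{β-1})` with `𝒜, ℬ > 0`,
`0 < α ≤ 1`, `α + β > 1`. -/
structure ConditionOne (c γ : ℕ → ℝ) (𝒜 ℬ α β : ℝ) : Prop where
  𝒜_pos : 0 < 𝒜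
  ℬ_pos : 0 < ℬ
  α_pos : 0 < α
  α_le_one : α ≤ 1
  one_lt_add : 1 < α + β
  c_asymp : (fun k : ℕ => c k - 𝒜 / ((k : ℝ) + 1) ^ α)
    =O[atTop] fun k : ℕ => 1 / ((k : ℝ) + 1) ^ (α + 1)
  γ_asymp : (fun k : ℕ => γ k - ℬ * ((k : ℝ) + 1) ^ β)
    =O[atTop] fun k : ℕ => ((k : ℝ) + 1) ^ (β - 1)

/-- Standing assumptions on the eigenvalues, counted with multiplicity, of the positive
self-adjoint operator with compact inverse: `1 ≤ a_1 ≤ a_2 ≤ …` and `a_n → ∞`. -/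
structure IsEigenvalueSeq (a : ℕ → ℝ) : Prop where
  one_le : 1 ≤ a 0
  mono : Monotone a
  tendsto : Tendsto a atTop atTop

/-- The Laplace transform `∑ c_k / (z + γ_k)` of the kernel. -/
def kernelHat (c γ : ℕ → ℝ) (z : ℂ) : ℂ :=
  ∑' k, (c k : ℂ) / (z + (γ k : ℂ))

/-- The function `z² + x² (1 - x^{-2(1-θ)} ∑ c_k / (z + γ_k))`; for `x = a_n` it is `ℓ_n`. -/
def ell (c γ : ℕ → ℝ) (θ x : ℝ) (z : ℂ) : ℂ :=
  z ^ 2 + (x : ℂ) ^ 2 * (1 - 1 / ((x ^ (2 * (1 - θ)) : ℝ) : ℂ) * kernelHat c γ z)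

/-- The zeros of the meromorphic function `ell c γ θ x`. Its poles `-γ_k`, where the formula
has no meaning, are not zeros. -/
def ellZeros (c γ : ℕ → ℝ) (θ x : ℝ) : Set ℂ :=
  {z | (∀ k, z ≠ -(γ k : ℂ)) ∧ ell c γ θ x z = 0}

/-- `r = (α + β - 1) / β`. -/
def rParam (α β : ℝ) : ℝ := (α + β - 1) / β

/-- `D₁ = -(π/2) cos (π (r + 1) / 2) / sin (π r)`, which is positive for `0 < r < 1`. -/
def D₁ (r : ℝ) : ℝ :=
  -(Real.pi / 2) * (Real.cos (Real.pi / 2 * (r + 1)) / Real.sin (Real.pi * r))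

/-- `D₂ = -(π/2) sin (π (r + 1) / 2) / sin (π r)`, which is negative for `0 < r < 1`. -/
def D₂ (r : ℝ) : ℝ :=
  -(Real.pi / 2) * (Real.sin (Real.pi / 2 * (r + 1)) / Real.sin (Real.pi * r))

/-- The exponent `n₁ = r + 2 (1/2 - θ)`. -/
def n₁ (θ r : ℝ) : ℝ := r + 2 * (1 / 2 - θ)

/-- The exponent `n₂ = min {2 (1 - θ), 2 r + 3 - 4 θ}`. -/
def n₂ (θ r : ℝ) : ℝ := min (2 * (1 - θ)) (2 * r + 3 - 4 * θ)

/-- The leading part, for `0 < r < 1`, of the zero `λ^±` belonging to the eigenvalue `x`;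
`s = 1` for `λ⁺` and `s = -1` for `λ⁻`. -/
def leadingTerm (𝒜 ℬ β θ r s x : ℝ) : ℂ :=
  -((𝒜 * D₁ r * ℬ ^ (r - 1) / (β * x ^ n₁ θ r) : ℝ) : ℂ)
    + (s : ℂ) * Complex.I * ((x + 𝒜 * D₂ r * ℬ ^ (r - 1) / (β * x ^ n₁ θ r) : ℝ) : ℂ)

/-- The leading part, for `r = 1`, of the zero `λ^±` belonging to the eigenvalue `x`. -/
def leadingTermLog (𝒜 β θ s x : ℝ) : ℂ :=
  -((1 / 2 * (𝒜 / β) * (Real.log x / x ^ (2 * (1 - θ))) : ℝ) : ℂ)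
    + (s : ℂ) * Complex.I * (x : ℂ)

/-- The asymptotic formulas, along the eigenvalues `a_n`, for a sequence `μ` of zeros with
sign `s`, in the three ranges of the parameters. -/
def HasZeroAsymptotics (a : ℕ → ℝ) (𝒜 ℬ β θ r s : ℝ) (μ : ℕ → ℂ) : Prop :=
  (0 < r → r < 1 / 2 → 1 / 2 ≤ θ →
    (fun n => μ n - leadingTerm 𝒜 ℬ β θ r s (a n)) =O[atTop] fun n => 1 / a n ^ n₂ θ r) ∧
  (0 < r → r < 1 → (1 / 2 ≤ r ∨ θ < 1 / 2) →
    (fun n => μ n - leadingTerm 𝒜 ℬ β θ r s (a n))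
      =O[atTop] fun n => 1 / a n ^ (2 * (1 - θ))) ∧
  (r = 1 →
    (fun n => μ n - leadingTermLog 𝒜 β θ s (a n))
      =O[atTop] fun n => 1 / a n ^ (2 * (1 - θ)))

end GurtinPipkin

end

noncomputable section

namespace GurtinPipkin

/-! ### The kernel off its poles -/

/-! Off the poles, a zero of `ℓ_n` solves `z² + b = M K(z)`, where `K` is the kernel transform, `b =
a_n²` and `M = a_n^(2θ)`. On the negative half-line `K` decreases between consecutive poles, so the
intermediate value theorem puts a zero into every gap (`Kernel.exists_zero_mem_gap`); the inequality
`M K(0) < b` serves the gap that ends at `0`.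

The count rests on divided differences. Over four distinct zeros, the third divided difference of
the equation kills `z² + b` and leaves `∑ c_k ∏ 1 / (z_i + γ_k) = 0`. If the four zeros split into
two pairs, each consisting of conjugate points or of two points of one gap, then every summand is
positive, a contradiction (`Kernel.false_of_definitePairs`). Once a zero is fixed in each gap, there
is room for at most two more (`Kernel.exists_zeros`).

For large `x = a_n` a non-real zero is found by iteration: `z = ix + w` turns the equation into `w =
M K(ix + w) / (2ix + w)`, a contraction whose fixed point differs from the first iterate `M K(ix) /
(2ix)` by a quadratic error (`Kernel.exists_zero_near`). It remains to expand `K(ix)`, which is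
`∫₁^∞ 𝒜 t^(-α) / (ℬ t^β + ix) dt + O(1/x)`. For `r < 1` the integral may start at `0` and becomes a
Mellin integral, the source of `D₁` and `D₂`; for `r = 1`, that is `α = 1`, it is elementary and
yields the logarithm. The terms of `K(ix)` lie in one quadrant, so the same expansion also bounds
the sum of their absolute values, which controls the contraction (`Kernel.absSum_le`). -/

lemma exists_norm_inv_add_le {γ : ℕ → ℝ} (hγ : ∀ k, 0 < γ k) (hlim : Tendsto γ atTop atTop)
    (z : ℂ) : ∃ C : ℝ, ∀ k, ‖(z + (γ k : ℂ))⁻¹‖ ≤ C / γ k := by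
  have h : (fun k => (z + (γ k : ℂ))⁻¹) =O[atTop] fun k => (γ k)⁻¹ := by
    refine IsBigO.of_bound 2 ?_
    filter_upwards [hlim.eventually_ge_atTop (2 * ‖z‖)] with k hk
    have h0 := hγ k
    have h1 : γ k / 2 ≤ ‖z + (γ k : ℂ)‖ := by
      have h2 := norm_sub_norm_le (γ k : ℂ) (-z)
      have h3 : ‖(γ k : ℂ)‖ = γ k := by simp [abs_of_pos h0]
      rw [h3, norm_neg, sub_neg_eq_add, add_comm] at h2
      linarith
    rw [norm_inv, norm_inv, Real.norm_of_nonneg h0.le]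
    calc (‖z + (γ k : ℂ)‖)⁻¹ ≤ (γ k / 2)⁻¹ := inv_anti₀ (by positivity) h1
      _ = 2 * (γ k)⁻¹ := by rw [inv_div]; ring
  -- The bound passes from large `k` to all `k` because `γ k` never vanishes. It holds even when `z`
  -- is a pole, where the inverse is `0`.
  obtain ⟨C, _, hC⟩ := bound_of_isBigO_nat_atTop h
  refine ⟨C, fun k => ?_⟩
  have h0 := hγ k
  have := hC (x := k) (by positivity)
  rwa [norm_inv (γ k), Real.norm_of_nonneg h0.le, ← div_eq_mul_inv] at this

variable {c γ : ℕ → ℝ}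

/-- The hypotheses on the kernel, without the normalisation of the sum. -/
structure Kernel (c γ : ℕ → ℝ) : Prop extends IsExpKernel c γ where
  summable : Summable fun k => c k / γ k

/-- The resolvent factor `1 / (z + γ_k)`. -/
def res (γ : ℕ → ℝ) (z : ℂ) (k : ℕ) : ℂ := (z + (γ k : ℂ))⁻¹

lemma kernelHat_eq (z : ℂ) : kernelHat c γ z = ∑' k, (c k : ℂ) * res γ z k := by
  simp only [kernelHat, res, div_eq_mul_inv]

lemma Kernel.summable_res (h : Kernel c γ) (z : ℂ) : Summable fun k => (c k : ℂ) * res γ z k := by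
  obtain ⟨C, hC⟩ := exists_norm_inv_add_le h.γ_pos h.γ_tendsto z
  refine Summable.of_norm_bounded (h.summable.mul_left C) fun k => ?_
  rw [norm_mul, Complex.norm_real, Real.norm_of_nonneg (h.c_pos k).le]
  calc c k * ‖res γ z k‖ ≤ c k * (C / γ k) := by gcongr; exacts [(h.c_pos k).le, hC k]
    _ = _ := by ring

lemma Kernel.summable_mul_res (h : Kernel c γ) {u : ℕ → ℂ} (hu : Summable u) (z : ℂ) :
    Summable fun k => u k * res γ z k := by
  obtain ⟨C, hC⟩ := exists_norm_inv_add_le h.γ_pos h.γ_tendsto z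
  refine Summable.of_norm_bounded (hu.norm.mul_left (|C| / γ 0)) fun k => ?_
  rw [norm_mul, mul_comm]
  have : ‖res γ z k‖ ≤ |C| / γ 0 := (hC k).trans (by
    have h0 := h.γ_pos 0
    have h1 := h.γ_strictMono.monotone (Nat.zero_le k)
    calc C / γ k ≤ |C| / γ k := by gcongr; exacts [(h.γ_pos k).le, le_abs_self C]
      _ ≤ _ := by gcongr)
  gcongr

/-- Off the poles. -/
def OffPoles (γ : ℕ → ℝ) (z : ℂ) : Prop := ∀ k, z ≠ -(γ k : ℂ)

lemma OffPoles.add_ne {z : ℂ} (hz : OffPoles γ z) (k : ℕ) : z + (γ k : ℂ) ≠ 0 :=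
  fun h => hz k (eq_neg_of_add_eq_zero_left h)

/-! ### Divided differences and definite pairs of zeros. -/

lemma res_sub_res {z w : ℂ} (hz : OffPoles γ z) (hw : OffPoles γ w) (k : ℕ) :
    res γ z k - res γ w k = (w - z) * (res γ z k * res γ w k) := by
  have h1 := hz.add_ne k
  have h2 := hw.add_ne k
  simp only [res]
  field_simp
  ring

/-- The resolvent identity, summed. Each use raises the order of a divided difference of the kernel
by one, appending one factor `res`. -/
lemma tsum_mul_res_sub {u : ℕ → ℂ} {z w : ℂ}
    (hzs : Summable fun k => u k * res γ z k) (hws : Summable fun k => u k * res γ w k)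
    (hz : OffPoles γ z) (hw : OffPoles γ w) :
    ∑' k, u k * res γ z k - ∑' k, u k * res γ w k
      = (w - z) * ∑' k, u k * res γ z k * res γ w k := by
  rw [← hzs.tsum_sub hws, ← tsum_mul_left]
  refine tsum_congr fun k => ?_
  rw [← mul_sub, res_sub_res hz hw]
  ring

/-- The equation `z² + b = M K(z)` off the poles. -/
def IsZero (c γ : ℕ → ℝ) (b M : ℝ) (z : ℂ) : Prop :=
  OffPoles γ z ∧ z ^ 2 + (b : ℂ) = M * kernelHat c γ z

/-- The third divided difference of the equation vanishes on four different zeros. -/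
lemma Kernel.tsum_four_eq_zero (h : Kernel c γ) {b M : ℝ} (hM : M ≠ 0) {z₁ z₂ z₃ z₄ : ℂ}
    (h₁ : IsZero c γ b M z₁) (h₂ : IsZero c γ b M z₂) (h₃ : IsZero c γ b M z₃)
    (h₄ : IsZero c γ b M z₄) (n₁₂ : z₁ ≠ z₂) (n₁₃ : z₁ ≠ z₃) (n₁₄ : z₁ ≠ z₄) (n₂₃ : z₂ ≠ z₃)
    (n₂₄ : z₂ ≠ z₄) (n₃₄ : z₃ ≠ z₄) :
    ∑' k, (c k : ℂ) * res γ z₁ k * res γ z₂ k * res γ z₃ k * res γ z₄ k = 0 := by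
  -- The polynomial side `z² + b` passes through the divided differences `z₁ + w`, then `1`, then
  -- `0`.
  have two : ∀ {w}, IsZero c γ b M w → z₁ ≠ w →
      z₁ + w = -(M * ∑' k, (c k : ℂ) * res γ z₁ k * res γ w k) := by
    intro w hw hne
    have e := tsum_mul_res_sub (h.summable_res z₁) (h.summable_res w) h₁.1 hw.1
    rw [← kernelHat_eq, ← kernelHat_eq] at e
    refine mul_left_cancel₀ (sub_ne_zero.mpr hne) ?_
    linear_combination h₁.2 - hw.2 + (M : ℂ) * e
  have hs₁ := h.summable_res z₁
  have three : ∀ {w}, IsZero c γ b M w → z₁ ≠ w → z₂ ≠ w →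
      1 = M * ∑' k, (c k : ℂ) * res γ z₁ k * res γ z₂ k * res γ w k := by
    intro w hw hne hne'
    have e := tsum_mul_res_sub (h.summable_mul_res hs₁ z₂) (h.summable_mul_res hs₁ w) h₂.1 hw.1
    refine mul_left_cancel₀ (sub_ne_zero.mpr hne') ?_
    linear_combination two h₂ n₁₂ - two hw hne - (M : ℂ) * e
  have hs₂ := h.summable_mul_res hs₁ z₂
  have e := tsum_mul_res_sub (h.summable_mul_res hs₂ z₃) (h.summable_mul_res hs₂ z₄) h₃.1 h₄.1
  have h5 : (M : ℂ) * ((z₄ - z₃) *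
      ∑' k, (c k : ℂ) * res γ z₁ k * res γ z₂ k * res γ z₃ k * res γ z₄ k) = 0 := by
    linear_combination three h₄ n₁₄ n₂₄ - three h₃ n₁₃ n₂₃ - (M : ℂ) * e
  simpa [hM, sub_ne_zero.mpr n₃₄.symm] using h5

/-- A pair of points at which all products `(z + γ_k) (w + γ_k)` are positive. -/
def DefinitePair (γ : ℕ → ℝ) (z w : ℂ) : Prop :=
  ∀ k, ∃ p : ℝ, 0 < p ∧ (z + (γ k : ℂ)) * (w + (γ k : ℂ)) = p

lemma DefinitePair.res_mul {z w : ℂ} (h : DefinitePair γ z w) (k : ℕ) :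
    ∃ p : ℝ, 0 < p ∧ res γ z k * res γ w k = p := by
  obtain ⟨p, hp, e⟩ := h k
  exact ⟨p⁻¹, inv_pos.mpr hp, by rw [res, res, ← mul_inv, e, Complex.ofReal_inv]⟩

/-- There are no two disjoint definite pairs of zeros. -/
lemma Kernel.false_of_definitePairs (h : Kernel c γ) {b M : ℝ} (hM : M ≠ 0) {z₁ z₂ z₃ z₄ : ℂ}
    (h₁ : IsZero c γ b M z₁) (h₂ : IsZero c γ b M z₂) (h₃ : IsZero c γ b M z₃)
    (h₄ : IsZero c γ b M z₄) (p₁₂ : DefinitePair γ z₁ z₂) (p₃₄ : DefinitePair γ z₃ z₄)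
    (n₁₂ : z₁ ≠ z₂) (n₁₃ : z₁ ≠ z₃) (n₁₄ : z₁ ≠ z₄) (n₂₃ : z₂ ≠ z₃)
    (n₂₄ : z₂ ≠ z₄) (n₃₄ : z₃ ≠ z₄) : False := by
  have h0 := h.tsum_four_eq_zero hM h₁ h₂ h₃ h₄ n₁₂ n₁₃ n₁₄ n₂₃ n₂₄ n₃₄
  have hs := h.summable_mul_res (h.summable_mul_res (h.summable_mul_res
    (h.summable_res z₁) z₂) z₃) z₄
  choose p hp ep using fun k => p₁₂.res_mul k
  choose q hq eq using fun k => p₃₄.res_mul k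
  have e : ∀ k, (c k : ℂ) * res γ z₁ k * res γ z₂ k * res γ z₃ k * res γ z₄ k
      = ((c k * p k * q k : ℝ) : ℂ) := by
    intro k
    push_cast
    rw [← ep, ← eq]
    ring
  simp only [e] at h0 hs
  rw [← Complex.ofReal_tsum, Complex.ofReal_eq_zero] at h0
  have hs' : Summable fun k => c k * p k * q k := Complex.summable_ofReal.mp hs
  have pos : ∀ k, 0 < c k * p k * q k := fun k => by
    have := h.c_pos k
    have := hp k
    have := hq k
    positivity
  exact (hs'.tsum_pos (fun k => (pos k).le) 0 (pos 0)).ne' h0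

lemma offPoles_of_im_ne_zero {z : ℂ} (hz : z.im ≠ 0) : OffPoles γ z := by
  rintro k rfl
  simp at hz

lemma definitePair_conj {z : ℂ} (hz : z.im ≠ 0) : DefinitePair γ z ((starRingEnd ℂ) z) := by
  intro k
  refine ⟨Complex.normSq (z + γ k), Complex.normSq_pos.mpr
    ((offPoles_of_im_ne_zero hz).add_ne k), ?_⟩
  rw [← Complex.mul_conj, map_add, Complex.conj_ofReal]

lemma ne_conj {z : ℂ} (hz : z.im ≠ 0) : z ≠ (starRingEnd ℂ) z := fun h =>
  hz (Complex.conj_eq_iff_im.mp h.symm)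

lemma kernelHat_conj (z : ℂ) :
    kernelHat c γ ((starRingEnd ℂ) z) = (starRingEnd ℂ) (kernelHat c γ z) := by
  rw [kernelHat, kernelHat, Complex.conj_tsum]
  simp

lemma IsZero.conj {b M : ℝ} {z : ℂ} (h : IsZero c γ b M z) :
    IsZero c γ b M ((starRingEnd ℂ) z) := by
  refine ⟨fun k hk => h.1 k ?_, ?_⟩
  · have := congrArg (starRingEnd ℂ) hk
    simpa using this
  · have := congrArg (starRingEnd ℂ) h.2
    simpa [kernelHat_conj] using this

/-! ### The kernel on the negative half-line -/

/-- The interval `(-γ_k, -γ_{k-1})`, or `(-γ_0, 0]` for `k = 0`. -/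
def gap (γ : ℕ → ℝ) (k : ℕ) : Set ℝ := {t | -γ k < t ∧ t ≤ 0 ∧ ∀ j < k, t < -γ j}

lemma gap_zero : gap γ 0 = Set.Ioc (-γ 0) 0 := by
  ext t
  simp [gap]

lemma gap_succ (h : IsExpKernel c γ) (k : ℕ) : gap γ (k + 1) = Set.Ioo (-γ (k + 1)) (-γ k) := by
  ext t
  refine ⟨fun ht => ⟨ht.1, ht.2.2 k k.lt_succ_self⟩, fun ht => ⟨ht.1, ?_, fun j hj => ?_⟩⟩
  · have := h.γ_pos k
    linarith [ht.2]
  · have := h.γ_strictMono.monotone (Nat.le_of_lt_succ hj)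
    linarith [ht.2]

lemma exists_mem_gap (h : IsExpKernel c γ) {t : ℝ} (ht : t ≤ 0) (hp : ∀ k, t ≠ -γ k) :
    ∃ k, t ∈ gap γ k := by
  classical
  have ex : ∃ k, -γ k < t := by
    obtain ⟨k, hk⟩ := (h.γ_tendsto.eventually_gt_atTop (-t)).exists
    exact ⟨k, by linarith⟩
  refine ⟨Nat.find ex, Nat.find_spec ex, ht, fun j hj => ?_⟩
  exact lt_of_le_of_ne (not_lt.mp (Nat.find_min ex hj)) (hp j)

/-- No pole lies inside a gap, so `t + γ j` keeps its sign there. Both the monotonicity of the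
kernel and the definiteness of pairs in one gap come from this. -/
lemma add_pos_or_neg (h : IsExpKernel c γ) {k : ℕ} (j : ℕ) :
    (∀ t ∈ gap γ k, 0 < t + γ j) ∨ (∀ t ∈ gap γ k, t + γ j < 0) := by
  rcases lt_or_ge j k with hj | hj
  · exact Or.inr fun t ht => by linarith [ht.2.2 j hj]
  · exact Or.inl fun t ht => by linarith [ht.1, h.γ_strictMono.monotone hj]

lemma mul_add_pos (h : IsExpKernel c γ) {k : ℕ} {s t : ℝ} (hs : s ∈ gap γ k) (ht : t ∈ gap γ k)
    (j : ℕ) : 0 < (s + γ j) * (t + γ j) := by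
  rcases add_pos_or_neg h (k := k) j with hj | hj
  · exact mul_pos (hj s hs) (hj t ht)
  · exact mul_pos_of_neg_of_neg (hj s hs) (hj t ht)

lemma add_ne_zero_of_mem_gap (h : IsExpKernel c γ) {k : ℕ} {t : ℝ} (ht : t ∈ gap γ k) (j : ℕ) :
    t + γ j ≠ 0 := fun h0 => by simpa [h0] using mul_add_pos h ht ht j

lemma definitePair_of_mem_gap (h : IsExpKernel c γ) {k : ℕ} {s t : ℝ} (hs : s ∈ gap γ k)
    (ht : t ∈ gap γ k) : DefinitePair γ s t := fun j =>
  ⟨_, mul_add_pos h hs ht j, by push_cast; rfl⟩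

/-- The values of the kernel on the real line. -/
def kernelReal (c γ : ℕ → ℝ) (t : ℝ) : ℝ := ∑' k, c k / (t + γ k)

lemma kernelHat_ofReal (t : ℝ) : kernelHat c γ t = kernelReal c γ t := by
  rw [kernelHat, kernelReal, Complex.ofReal_tsum]
  push_cast
  rfl

lemma Kernel.summable_real (h : Kernel c γ) (t : ℝ) : Summable fun k => c k / (t + γ k) := by
  refine Complex.summable_ofReal.mp ((h.summable_res t).congr fun k => ?_)
  simp [res, div_eq_mul_inv]

lemma Kernel.term_antitoneOn (h : Kernel c γ) (k j : ℕ) :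
    AntitoneOn (fun t => c j / (t + γ j)) (gap γ k) := by
  intro s hs t ht hst
  have hc := h.c_pos j
  have e : c j / (s + γ j) - c j / (t + γ j) = c j * (t - s) / ((s + γ j) * (t + γ j)) := by
    have h1 := add_ne_zero_of_mem_gap h.toIsExpKernel hs j
    have h2 := add_ne_zero_of_mem_gap h.toIsExpKernel ht j
    field_simp
    ring
  have : 0 ≤ c j * (t - s) / ((s + γ j) * (t + γ j)) :=
    div_nonneg (mul_nonneg hc.le (by linarith)) (mul_add_pos h.toIsExpKernel hs ht j).le
  simp only
  linarith

lemma Kernel.kernelReal_antitoneOn (h : Kernel c γ) (k : ℕ) :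
    AntitoneOn (kernelReal c γ) (gap γ k) := fun s hs t ht hst =>
  (h.summable_real t).tsum_le_tsum (fun j => h.term_antitoneOn k j hs ht hst) (h.summable_real s)

/-- Near a pole the singular term alone decides: the rest of the kernel is still antitone, hence
bounded on the relevant side by its value at a fixed point of the gap. -/
lemma Kernel.remainder_le (h : Kernel c γ) {k : ℕ} (i : ℕ) {s t : ℝ} (hs : s ∈ gap γ k)
    (ht : t ∈ gap γ k) (hst : s ≤ t) :
    kernelReal c γ t - c i / (t + γ i) ≤ kernelReal c γ s - c i / (s + γ i) := by
  have e : ∀ t, kernelReal c γ t - c i / (t + γ i)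
      = ∑' j, if j = i then 0 else c j / (t + γ j) := fun t => by
    rw [kernelReal, (h.summable_real t).tsum_eq_add_tsum_ite i]
    ring
  have sm : ∀ t, Summable fun j => if j = i then 0 else c j / (t + γ j) := fun t => by
    refine ((h.summable_real t).indicator {i}ᶜ).congr fun j => ?_
    by_cases hj : j = i <;> simp [hj]
  rw [e, e]
  refine (sm t).tsum_le_tsum (fun j => ?_) (sm s)
  split_ifs
  · rfl
  · exact h.term_antitoneOn k j hs ht hst

lemma gap_ordConnected (γ : ℕ → ℝ) (k : ℕ) : (gap γ k).OrdConnected :=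
  ⟨fun _ hs _ ht _ hx => ⟨hs.1.trans_le hx.1, hx.2.trans ht.2.1,
    fun j hj => hx.2.trans_lt (ht.2.2 j hj)⟩⟩

/-- Each term is monotone on `[s, e]`, so its values at the two ends give a summable majorant. -/
lemma Kernel.kernelReal_continuousOn (h : Kernel c γ) {k : ℕ} {s e : ℝ} (hs : s ∈ gap γ k)
    (he : e ∈ gap γ k) : ContinuousOn (kernelReal c γ) (Set.Icc s e) := by
  have mem : ∀ t ∈ Set.Icc s e, t ∈ gap γ k := fun t ht => (gap_ordConnected γ k).out hs he ht
  refine continuousOn_tsum (u := fun j => |c j / (s + γ j)| + |c j / (e + γ j)|) (fun j => ?_)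
    ((h.summable_real s).abs.add (h.summable_real e).abs) fun j t ht => ?_
  · exact continuousOn_const.div (by fun_prop) fun t ht =>
      add_ne_zero_of_mem_gap h.toIsExpKernel (mem t ht) j
  · have h1 := h.term_antitoneOn k j hs (mem t ht) ht.1
    have h2 := h.term_antitoneOn k j (mem t ht) he ht.2
    simp only at h1 h2
    rw [Real.norm_eq_abs, abs_le]
    constructor
    · linarith [neg_abs_le (c j / (e + γ j)), abs_nonneg (c j / (s + γ j))]
    · linarith [le_abs_self (c j / (s + γ j)), abs_nonneg (c j / (e + γ j))]

/-! ### The set of zeros -/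

lemma mem_gap_unique {j k : ℕ} {t : ℝ} (hj : t ∈ gap γ j) (hk : t ∈ gap γ k) : j = k := by
  rcases lt_trichotomy j k with h | h | h
  · exact absurd hj.1 (hk.2.2 j h).le.not_gt
  · exact h
  · exact absurd hk.1 (hj.2.2 k h).le.not_gt

lemma gap_nonempty (h : IsExpKernel c γ) (k : ℕ) : (gap γ k).Nonempty := by
  cases k with
  | zero => rw [gap_zero]; exact Set.nonempty_Ioc.mpr (by linarith [h.γ_pos 0])
  | succ k =>
    rw [gap_succ h]
    exact Set.nonempty_Ioo.mpr (by linarith [h.γ_strictMono k.lt_succ_self])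

lemma Kernel.kernelReal_le_zero_value (h : Kernel c γ) {t : ℝ} (ht : 0 ≤ t) :
    kernelReal c γ t ≤ kernelReal c γ 0 :=
  (h.summable_real t).tsum_le_tsum (fun j => by
    have := h.γ_pos j
    have := h.c_pos j
    gcongr) (h.summable_real 0)

lemma Kernel.kernelReal_zero_pos (h : Kernel c γ) : 0 < kernelReal c γ 0 := by
  have pos : ∀ k, 0 < c k / (0 + γ k) := fun k => by
    have := h.γ_pos k
    have := h.c_pos k
    positivity
  exact (h.summable_real 0).tsum_pos (fun k => (pos k).le) 0 (pos 0)

/-- The kernel tends to `+∞` at the left end of a gap. -/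
lemma Kernel.exists_kernelReal_gt (h : Kernel c γ) (k : ℕ) {m : ℝ} (hm : m ∈ gap γ k) (Q : ℝ) :
    ∃ t ∈ gap γ k, t ≤ m ∧ Q < kernelReal c γ t := by
  set R := kernelReal c γ m - c k / (m + γ k) with hR
  -- The first entry keeps `-γ k + δ` to the left of `m`; the second makes the singular term at
  -- least `|Q - R| + 1`.
  set δ := min (m + γ k) (c k / (|Q - R| + 1)) with hδ
  have hc := h.c_pos k
  have hmk : 0 < m + γ k := by linarith [hm.1]
  have hδ0 : 0 < δ := lt_min hmk (by positivity)
  have htm : -γ k + δ ≤ m := by linarith [min_le_left (m + γ k) (c k / (|Q - R| + 1))]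
  have ht : -γ k + δ ∈ gap γ k :=
    ⟨by linarith, htm.trans hm.2.1, fun j hj => htm.trans_lt (hm.2.2 j hj)⟩
  refine ⟨_, ht, htm, ?_⟩
  have h1 := h.remainder_le k ht hm htm
  have h2 : |Q - R| + 1 ≤ c k / (-γ k + δ + γ k) := by
    rw [show -γ k + δ + γ k = δ by ring, le_div_iff₀ hδ0]
    calc (|Q - R| + 1) * δ ≤ (|Q - R| + 1) * (c k / (|Q - R| + 1)) := by
          gcongr
          exact min_le_right _ _
      _ = c k := by field_simp
  have h3 := le_abs_self (Q - R)
  linarith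

/-- The kernel takes negative values in every gap but the first. -/
lemma Kernel.exists_kernelReal_lt (h : Kernel c γ) (k : ℕ) {m : ℝ} (hm : m ∈ gap γ (k + 1)) :
    ∃ t ∈ gap γ (k + 1), m ≤ t ∧ kernelReal c γ t < 0 := by
  set R := kernelReal c γ m - c k / (m + γ k) with hR
  have hm' := hm
  rw [gap_succ h.toIsExpKernel] at hm'
  set δ := min (-γ k - m) (c k / (|R| + 1)) with hδ
  have hc := h.c_pos k
  have hmk : 0 < -γ k - m := by linarith [hm'.2]
  have hδ0 : 0 < δ := lt_min hmk (by positivity)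
  have htm : m ≤ -γ k - δ := by linarith [min_le_left (-γ k - m) (c k / (|R| + 1))]
  have ht : -γ k - δ ∈ gap γ (k + 1) := by
    rw [gap_succ h.toIsExpKernel]
    exact ⟨by linarith [hm'.1], by linarith⟩
  refine ⟨_, ht, htm, ?_⟩
  have h1 := h.remainder_le k hm ht htm
  have h2 : |R| + 1 ≤ c k / δ := by
    rw [le_div_iff₀ hδ0]
    calc (|R| + 1) * δ ≤ (|R| + 1) * (c k / (|R| + 1)) := by
          gcongr
          exact min_le_right _ _
      _ = c k := by field_simp
  have h3 := le_abs_self R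
  rw [show -γ k - δ + γ k = -δ by ring, div_neg] at h1
  linarith

lemma isZero_ofReal_iff {b M t : ℝ} :
    IsZero c γ b M t ↔ (∀ k, t ≠ -γ k) ∧ t ^ 2 + b = M * kernelReal c γ t := by
  rw [IsZero, OffPoles, kernelHat_ofReal]
  norm_cast

lemma Kernel.exists_zero_mem_gap (h : Kernel c γ) {b M : ℝ} (hM : 0 < M)
    (hb : M * kernelReal c γ 0 < b) (k : ℕ) : ∃ t ∈ gap γ k, IsZero c γ b M t := by
  have hb0 : 0 < b := (mul_pos hM h.kernelReal_zero_pos).trans hb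
  obtain ⟨e, he, hep⟩ : ∃ e ∈ gap γ k, M * kernelReal c γ e ≤ e ^ 2 + b := by
    cases k with
    | zero =>
      refine ⟨0, ?_, by linarith⟩
      rw [gap_zero]
      exact ⟨by linarith [h.γ_pos 0], le_rfl⟩
    | succ k =>
      obtain ⟨m, hm⟩ := gap_nonempty h.toIsExpKernel (k + 1)
      obtain ⟨t, ht, -, hn⟩ := h.exists_kernelReal_lt k hm
      exact ⟨t, ht, by nlinarith [sq_nonneg t, mul_pos_of_neg_of_neg hn (neg_lt_zero.mpr hM)]⟩
  -- On the whole gap `s ^ 2 ≤ γ k ^ 2`, so this threshold beats `s ^ 2 + b` wherever `s` turns out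
  -- to be.
  obtain ⟨s, hs, hse, hsQ⟩ := h.exists_kernelReal_gt k he (((γ k) ^ 2 + b) / M)
  have hsp : s ^ 2 + b ≤ M * kernelReal c γ s := by
    rw [div_lt_iff₀ hM] at hsQ
    nlinarith [hs.1, hs.2.1]
  have cont : ContinuousOn (fun t => t ^ 2 + b - M * kernelReal c γ t) (Set.Icc s e) :=
    ContinuousOn.sub (by fun_prop) (continuousOn_const.mul (h.kernelReal_continuousOn hs he))
  obtain ⟨t, ht, ht0⟩ := intermediate_value_Icc hse cont
    (show (0 : ℝ) ∈ Set.Icc _ _ from ⟨by linarith, by linarith⟩)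
  have htg := (gap_ordConnected γ k).out hs he ht
  refine ⟨t, htg, isZero_ofReal_iff.mpr ⟨fun j hj => ?_, by simp only at ht0; linarith⟩⟩
  exact add_ne_zero_of_mem_gap h.toIsExpKernel htg j (by rw [hj]; ring)

lemma Kernel.zero_neg (h : Kernel c γ) {b M t : ℝ} (hM : 0 < M)
    (hb : M * kernelReal c γ 0 < b) (ht : IsZero c γ b M t) : t < 0 := by
  by_contra! h0
  have h1 := h.kernelReal_le_zero_value h0
  have h2 := (isZero_ofReal_iff.mp ht).2
  nlinarith [mul_le_mul_of_nonneg_left h1 hM.le]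

lemma Kernel.zero_mem_gap (h : Kernel c γ) {b M t : ℝ} (hM : 0 < M)
    (hb : M * kernelReal c γ 0 < b) (ht : IsZero c γ b M t) : ∃ k, t ∈ gap γ k :=
  exists_mem_gap h.toIsExpKernel (h.zero_neg hM hb ht).le (isZero_ofReal_iff.mp ht).1

/-- The set of zeros: one in each gap, and at most two more. -/
theorem Kernel.exists_zeros (h : Kernel c γ) {b M : ℝ} (hM : 0 < M)
    (hb : M * kernelReal c γ 0 < b) :
    ∃ (lam : ℕ → ℝ) (p m : ℂ),
      {z | IsZero c γ b M z} = Set.range (fun k => (lam k : ℂ)) ∪ {p, m} ∧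
      (∀ k, lam k ∈ gap γ k) ∧
      ∀ z, IsZero c γ b M z → 0 < z.im → p = z ∧ m = (starRingEnd ℂ) z := by
  choose lam hlam hzero using h.exists_zero_mem_gap hM hb
  have real : ∀ z : ℂ, z.im = 0 → z = ((z.re : ℝ) : ℂ) := fun z hz =>
    Complex.ext (by simp) (by simp [hz])
  have pair : ∀ {s t : ℝ} {k : ℕ}, s ∈ gap γ k → t ∈ gap γ k → DefinitePair γ s t :=
    fun hs ht => definitePair_of_mem_gap h.toIsExpKernel hs ht
  by_cases hex : ∃ z, IsZero c γ b M z ∧ 0 < z.im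
  · obtain ⟨z, hz, him⟩ := hex
    have hset : {z | IsZero c γ b M z}
        = Set.range (fun k => (lam k : ℂ)) ∪ {z, (starRingEnd ℂ) z} := by
      ext w
      constructor
      · intro hw
        by_contra hn
        simp only [Set.mem_union, Set.mem_range, Set.mem_insert_iff, Set.mem_singleton_iff,
          not_or, not_exists] at hn
        obtain ⟨hn1, hn2, hn3⟩ := hn
        -- A further zero would bring a second definite pair besides `z` and its conjugate: with the
        -- chosen zero of its gap if it is real, with its own conjugate otherwise.
        by_cases hwi : w.im = 0
        · rw [real w hwi] at hw hn1
          obtain ⟨k, hk⟩ := h.zero_mem_gap hM hb hw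
          refine h.false_of_definitePairs hM.ne' hz hz.conj hw (hzero k)
            (definitePair_conj him.ne') (pair hk (hlam k)) (ne_conj him.ne') ?_ ?_ ?_ ?_
            (fun e => hn1 k e.symm)
          all_goals
            intro e
            have := congrArg Complex.im e
            simp at this
            linarith
        · refine h.false_of_definitePairs hM.ne' hz hz.conj hw (IsZero.conj hw)
            (definitePair_conj him.ne') (definitePair_conj hwi) (ne_conj him.ne')
            (Ne.symm hn2) (fun e => hn3 (by rw [e, Complex.conj_conj])) (Ne.symm hn3)
            (fun e => hn2 ((starRingEnd ℂ).injective e).symm) (ne_conj hwi)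
      · rintro (⟨k, rfl⟩ | rfl | rfl)
        exacts [hzero k, hz, hz.conj]
    refine ⟨lam, z, (starRingEnd ℂ) z, hset, hlam, fun w hw hwi => ?_⟩
    have : w ∈ {z | IsZero c γ b M z} := hw
    rw [hset] at this
    rcases this with ⟨k, rfl⟩ | rfl | rfl
    · simp at hwi
    · exact ⟨rfl, rfl⟩
    · rw [Complex.conj_im] at hwi
      linarith
  · push Not at hex
    have him : ∀ z, IsZero c γ b M z → z.im = 0 := fun z hz =>
      le_antisymm (hex z hz) (by simpa using hex _ hz.conj)
    -- All zeros are real here. The set records no multiplicities, so `p` and `m` may coincide or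
    -- repeat some `lam k` when fewer than two extra zeros exist.
    suffices key : ∃ p m : ℂ, IsZero c γ b M p ∧ IsZero c γ b M m ∧
        ∀ z, IsZero c γ b M z → z ∉ Set.range (fun k => (lam k : ℂ)) → z = p ∨ z = m by
      obtain ⟨p, m, hp, hm, hpm⟩ := key
      refine ⟨lam, p, m, ?_, hlam, fun z hz h0 => absurd h0 (hex z hz).not_gt⟩
      ext z
      refine ⟨fun hz => or_iff_not_imp_left.mpr (hpm z hz), ?_⟩
      rintro (⟨k, rfl⟩ | rfl | rfl)
      exacts [hzero k, hp, hm]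
    by_cases hE : ∃ p, IsZero c γ b M p ∧ p ∉ Set.range (fun k => (lam k : ℂ))
    · obtain ⟨p, hp, hpr⟩ := hE
      by_cases hE' : ∃ m, IsZero c γ b M m ∧ m ∉ Set.range (fun k => (lam k : ℂ)) ∧ m ≠ p
      · obtain ⟨m, hm, hmr, hmp⟩ := hE'
        refine ⟨p, m, hp, hm, fun z hz hzr => ?_⟩
        by_contra! hne
        rw [real p (him p hp)] at *
        rw [real m (him m hm)] at *
        rw [real z (him z hz)] at *
        simp only [Set.mem_range, not_exists] at hpr hmr hzr
        obtain ⟨k, hk⟩ := h.zero_mem_gap hM hb hp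
        -- Every extra zero shares the gap of `p`: in another gap it would form, with the chosen
        -- zero there, a definite pair disjoint from `p` and `lam k`. Three extra zeros then give
        -- four zeros in a single gap, which split into two definite pairs.
        have same : ∀ t : ℝ, IsZero c γ b M t → (∀ j, (lam j : ℂ) ≠ t) → (t : ℂ) ≠ p.re →
            t ∈ gap γ k := by
          intro t ht htr htp
          obtain ⟨j, hj⟩ := h.zero_mem_gap hM hb ht
          rcases eq_or_ne j k with rfl | hjk
          · exact hj
          · refine (h.false_of_definitePairs hM.ne' hp (hzero k) ht (hzero j) (pair hk (hlam k))
              (pair hj (hlam j)) (Ne.symm (hpr k)) htp.symm (Ne.symm (hpr j)) (htr k) (fun e => hjk ?_)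
              (htr j).symm).elim
            have e' : lam k = lam j := by exact_mod_cast e
            exact mem_gap_unique (hlam j) (e' ▸ hlam k)
        exact h.false_of_definitePairs hM.ne' hp (hzero k) hm hz (pair hk (hlam k))
          (pair (same _ hm hmr hmp) (same _ hz hzr hne.1)) (Ne.symm (hpr k)) hmp.symm hne.1.symm
          (hmr k) (hzr k) hne.2.symm
      · push Not at hE'
        exact ⟨p, p, hp, hp, fun z hz hzr => Or.inl (hE' z hz hzr)⟩
    · push Not at hE
      exact ⟨lam 0, lam 0, hzero 0, hzero 0, fun z hz hzr => absurd (hE z hz) hzr⟩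

/-- Zeros in a gap approach its left end as the coefficient `b / M` tends to infinity. -/
theorem Kernel.tendsto_zero_of_mem_gap (h : Kernel c γ) {b M lam : ℕ → ℝ} {k : ℕ}
    (hM : ∀ n, 0 < M n) (hlim : Tendsto (fun n => b n / M n) atTop atTop)
    (hmem : ∀ n, lam n ∈ gap γ k) (hzero : ∀ n, IsZero c γ (b n) (M n) (lam n)) :
    Tendsto lam atTop (𝓝 (-γ k)) := by
  refine tendsto_order.mpr ⟨fun s hs => Eventually.of_forall fun n => hs.trans (hmem n).1,
    fun s hs => ?_⟩
  obtain ⟨m, hm⟩ := gap_nonempty h.toIsExpKernel k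
  obtain ⟨t, ht, hts⟩ : ∃ t ∈ gap γ k, t < s := by
    have h1 : -γ k < min m s := lt_min hm.1 hs
    refine ⟨(-γ k + min m s) / 2, (gap_ordConnected γ k).out' ?_ hm ⟨le_rfl, ?_⟩, ?_⟩
    · exact ⟨by linarith, by linarith [hm.2.1, min_le_left m s],
        fun j hj => by linarith [hm.2.2 j hj, min_le_left m s]⟩
    · linarith [min_le_left m s]
    · linarith [min_le_right m s]
  filter_upwards [hlim.eventually_gt_atTop (kernelReal c γ t)] with n hn
  -- A zero at or beyond `s` would satisfy `K ≤ K(t) < b / M` by monotonicity, while the equation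
  -- forces `K ≥ b / M`.
  by_contra! hle
  have h1 := h.kernelReal_antitoneOn k ht (hmem n) (hts.le.trans hle)
  have h2 := (isZero_ofReal_iff.mp (hzero n)).2
  rw [lt_div_iff₀ (hM n)] at hn
  nlinarith [sq_nonneg (lam n), hM n]

/-! ### The zero near `i x` -/

/-- The sum of the absolute values of the terms of the kernel at `i x`. -/
def absSum (c γ : ℕ → ℝ) (x : ℝ) : ℝ := ∑' k, c k * ‖res γ (Complex.I * x) k‖

lemma Kernel.summable_abs (h : Kernel c γ) (x : ℝ) :
    Summable fun k => c k * ‖res γ (Complex.I * x) k‖ := by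
  refine (h.summable_res (Complex.I * x)).norm.congr fun k => ?_
  rw [norm_mul, Complex.norm_real, Real.norm_of_nonneg (h.c_pos k).le]

lemma Kernel.absSum_nonneg (h : Kernel c γ) (x : ℝ) : 0 ≤ absSum c γ x :=
  tsum_nonneg fun k => mul_nonneg (h.c_pos k).le (norm_nonneg _)

lemma le_norm_I_mul_add (γ : ℕ → ℝ) {x : ℝ} (hx : 0 < x) (k : ℕ) :
    x ≤ ‖Complex.I * x + (γ k : ℂ)‖ := by
  have := Complex.abs_im_le_norm (Complex.I * x + (γ k : ℂ))
  simpa [abs_of_pos hx] using this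

lemma norm_res_I_le {x : ℝ} (hx : 0 < x) (k : ℕ) : ‖res γ (Complex.I * x) k‖ ≤ 1 / x := by
  rw [res, norm_inv, one_div]
  exact inv_anti₀ hx (le_norm_I_mul_add γ hx k)

lemma half_le_im {x : ℝ} {w : ℂ} (hw : ‖w‖ ≤ x / 2) : x / 2 ≤ (Complex.I * x + w).im := by
  have := (abs_le.mp ((Complex.abs_im_le_norm w).trans hw)).1
  simp
  linarith

lemma norm_res_le {x : ℝ} (hx : 0 < x) {w : ℂ} (hw : ‖w‖ ≤ x / 2) (k : ℕ) :
    ‖res γ (Complex.I * x + w) k‖ ≤ 2 * ‖res γ (Complex.I * x) k‖ := by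
  have h1 := le_norm_I_mul_add γ hx k
  have h2 := norm_sub_norm_le (Complex.I * x + (γ k : ℂ)) (-w)
  rw [norm_neg, sub_neg_eq_add, show Complex.I * x + (γ k : ℂ) + w
    = Complex.I * x + w + (γ k : ℂ) by ring] at h2
  rw [res, res, norm_inv, norm_inv]
  have h3 : ‖Complex.I * x + (γ k : ℂ)‖ / 2 ≤ ‖Complex.I * x + w + (γ k : ℂ)‖ := by linarith
  calc (‖Complex.I * x + w + (γ k : ℂ)‖)⁻¹ ≤ (‖Complex.I * x + (γ k : ℂ)‖ / 2)⁻¹ :=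
        inv_anti₀ (by linarith) h3
    _ = 2 * (‖Complex.I * x + (γ k : ℂ)‖)⁻¹ := by rw [inv_div]; ring

lemma Kernel.norm_kernelHat_le (h : Kernel c γ) {x : ℝ} (hx : 0 < x) {w : ℂ} (hw : ‖w‖ ≤ x / 2) :
    ‖kernelHat c γ (Complex.I * x + w)‖ ≤ 2 * absSum c γ x := by
  rw [kernelHat_eq, absSum, ← tsum_mul_left]
  refine tsum_of_norm_bounded ((h.summable_abs x).mul_left 2).hasSum fun k => ?_
  rw [norm_mul, Complex.norm_real, Real.norm_of_nonneg (h.c_pos k).le]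
  nlinarith [norm_res_le (γ := γ) hx hw k, h.c_pos k]

/-- The resolvent identity produces two factors `res`: one is at most `2 / x`, the other is kept for
the sum. -/
lemma Kernel.norm_kernelHat_sub_le (h : Kernel c γ) {x : ℝ} (hx : 0 < x) {v w : ℂ}
    (hv : ‖v‖ ≤ x / 2) (hw : ‖w‖ ≤ x / 2) :
    ‖kernelHat c γ (Complex.I * x + v) - kernelHat c γ (Complex.I * x + w)‖
      ≤ 4 * absSum c γ x / x * ‖v - w‖ := by
  have off : ∀ {u : ℂ}, ‖u‖ ≤ x / 2 → OffPoles γ (Complex.I * x + u) := fun hu =>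
    offPoles_of_im_ne_zero (by linarith [half_le_im hu])
  rw [kernelHat_eq, kernelHat_eq, tsum_mul_res_sub (h.summable_res _) (h.summable_res _)
    (off hv) (off hw), norm_mul, mul_comm]
  rw [show Complex.I * x + w - (Complex.I * x + v) = -(v - w) by ring, norm_neg]
  gcongr
  rw [mul_div_right_comm, absSum, ← tsum_mul_left]
  refine tsum_of_norm_bounded ((h.summable_abs x).mul_left (4 / x)).hasSum fun k => ?_
  rw [norm_mul, norm_mul, Complex.norm_real, Real.norm_of_nonneg (h.c_pos k).le]
  have hc := (h.c_pos k).le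
  have h1 := norm_res_le (γ := γ) hx hv k
  have h2 := norm_res_le (γ := γ) hx hw k
  have h3 := norm_res_I_le (γ := γ) hx k
  calc c k * ‖res γ (Complex.I * x + v) k‖ * ‖res γ (Complex.I * x + w) k‖
      ≤ c k * (2 * ‖res γ (Complex.I * x) k‖) * (2 * (1 / x)) := by
        gcongr
        exact h2.trans (by gcongr)
    _ = 4 / x * (c k * ‖res γ (Complex.I * x) k‖) := by ring

/-- Every term of the kernel at `i x` has positive real and negative imaginary part, and there `|u|
≤ Re u - Im u`. So the sum has no serious cancellation. -/
lemma Kernel.absSum_le (h : Kernel c γ) {x : ℝ} (hx : 0 < x) :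
    absSum c γ x ≤ 2 * ‖kernelHat c γ (Complex.I * x)‖ := by
  have hs := h.summable_res (Complex.I * x)
  have key : absSum c γ x ≤ (kernelHat c γ (Complex.I * x)).re
      - (kernelHat c γ (Complex.I * x)).im := by
    rw [kernelHat_eq, Complex.re_tsum hs, Complex.im_tsum hs,
      ← (Complex.hasSum_re hs.hasSum).summable.tsum_sub (Complex.hasSum_im hs.hasSum).summable]
    refine (h.summable_abs x).tsum_le_tsum (fun k => ?_)
      ((Complex.hasSum_re hs.hasSum).summable.sub (Complex.hasSum_im hs.hasSum).summable)
    rw [Complex.re_ofReal_mul, Complex.im_ofReal_mul, ← mul_sub]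
    refine mul_le_mul_of_nonneg_left ?_ (h.c_pos k).le
    have hg := h.γ_pos k
    set u := Complex.I * x + (γ k : ℂ) with hu
    have hur : u.re = γ k := by simp [hu]
    have hui : u.im = x := by simp [hu]
    have hpos : 0 < ‖u‖ := hx.trans_le (le_norm_I_mul_add γ hx k)
    have hle : ‖u‖ ≤ γ k + x := by
      have := Complex.norm_le_abs_re_add_abs_im u
      rwa [hur, hui, abs_of_pos hg, abs_of_pos hx] at this
    rw [res, ← hu, Complex.inv_re, Complex.inv_im, hur, hui, norm_inv, ← sub_div,
      sub_neg_eq_add, Complex.normSq_eq_norm_sq, le_div_iff₀ (by positivity), pow_two,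
      inv_mul_cancel_left₀ hpos.ne']
    exact hle
  have h1 := (le_abs_self _).trans (Complex.abs_re_le_norm (kernelHat c γ (Complex.I * x)))
  have h2 := (neg_le_abs _).trans (Complex.abs_im_le_norm (kernelHat c γ (Complex.I * x)))
  linarith

/-- A zero near `i x`, from the contraction `w ↦ M K(ix + w) / (2ix + w)`. -/
theorem Kernel.exists_zero_near (h : Kernel c γ) {x M : ℝ} (hx : 0 < x) (hM : 0 ≤ M)
    (hq : 8 * (M * absSum c γ x / x ^ 2) ≤ 1) :
    ∃ z, IsZero c γ (x ^ 2) M z ∧ 0 < z.im ∧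
      ‖z - Complex.I * x - M * kernelHat c γ (Complex.I * x) / (2 * (Complex.I * x))‖
        ≤ 8 * (M * absSum c γ x / x ^ 2) ^ 2 * x := by
  set S := absSum c γ x with hS
  have hS0 : 0 ≤ S := h.absSum_nonneg x
  set q := M * S / x ^ 2 with hqdef
  have hq0 : 0 ≤ q := by positivity
  have hMS : M * S = q * x ^ 2 := by rw [hqdef]; field_simp
  set T : ℂ → ℂ := fun w => M * kernelHat c γ (Complex.I * x + w) / (2 * (Complex.I * x) + w)
    with hT
  have den : ∀ {w : ℂ}, ‖w‖ ≤ x / 2 → 3 / 2 * x ≤ ‖2 * (Complex.I * x) + w‖ := by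
    intro w hw
    have h1 := Complex.abs_im_le_norm (2 * (Complex.I * x) + w)
    have h2 := half_le_im hw
    have h3 := le_abs_self (2 * (Complex.I * x) + w).im
    simp at h2 h3 h1
    linarith
  have den0 : ∀ {w : ℂ}, ‖w‖ ≤ x / 2 → 2 * (Complex.I * x) + w ≠ 0 := fun hw h0 => by
    have := den hw
    rw [h0, norm_zero] at this
    linarith
  have hMn : ‖(M : ℂ)‖ = M := by rw [Complex.norm_real, Real.norm_of_nonneg hM]
  have bound : ∀ {w : ℂ}, ‖w‖ ≤ x / 2 → ‖T w‖ ≤ 2 * q * x := by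
    intro w hw
    rw [hT, norm_div, norm_mul, hMn, div_le_iff₀ (by linarith [den hw])]
    calc M * ‖kernelHat c γ (Complex.I * x + w)‖ ≤ M * (2 * S) := by
          gcongr
          exact h.norm_kernelHat_le hx hw
      _ = 2 * (q * x ^ 2) := by rw [← hMS]; ring
      _ ≤ 2 * q * x * (3 / 2 * x) := by nlinarith [mul_nonneg hq0 (sq_nonneg x)]
      _ ≤ _ := by gcongr; exact den hw
  have lip : ∀ {v w : ℂ}, ‖v‖ ≤ x / 2 → ‖w‖ ≤ x / 2 → ‖T v - T w‖ ≤ 4 * q * ‖v - w‖ := by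
    intro v w hv hw
    -- Written with a single denominator, so that the difference of denominators is paid for by the
    -- bound on `T w`.
    have e : T v - T w = (M * (kernelHat c γ (Complex.I * x + v) - kernelHat c γ (Complex.I * x + w))
        - T w * (v - w)) / (2 * (Complex.I * x) + v) := by
      have hTv : T v * (2 * (Complex.I * x) + v) = M * kernelHat c γ (Complex.I * x + v) :=
        div_mul_cancel₀ _ (den0 hv)
      have hTw : T w * (2 * (Complex.I * x) + w) = M * kernelHat c γ (Complex.I * x + w) :=
        div_mul_cancel₀ _ (den0 hw)
      rw [eq_div_iff (den0 hv)]
      linear_combination hTv - hTw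
    rw [e, norm_div, div_le_iff₀ (by linarith [den hv])]
    calc ‖(M : ℂ) * (kernelHat c γ (Complex.I * x + v) - kernelHat c γ (Complex.I * x + w))
        - T w * (v - w)‖
        ≤ M * (4 * S / x * ‖v - w‖) + 2 * q * x * ‖v - w‖ := by
          refine (norm_sub_le _ _).trans ?_
          rw [norm_mul, norm_mul, hMn]
          gcongr
          · exact h.norm_kernelHat_sub_le hx hv hw
          · exact bound hw
      -- `4` from the kernel and `2` from the denominator make `6 = 4 * (3 / 2)`.
      _ = 4 * q * ‖v - w‖ * (3 / 2 * x) := by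
          rw [show M * (4 * S / x * ‖v - w‖) = 4 * (M * S) / x * ‖v - w‖ by ring, hMS]
          field_simp
          ring
      _ ≤ _ := by gcongr; exact den hv
  have hcomplete : IsComplete (Metric.closedBall (0 : ℂ) (x / 2)) :=
    Metric.isClosed_closedBall.isComplete
  have maps : Set.MapsTo T (Metric.closedBall 0 (x / 2)) (Metric.closedBall 0 (x / 2)) := by
    intro w hw
    rw [mem_closedBall_zero_iff] at hw ⊢
    exact (bound hw).trans (by nlinarith)
  -- The hypothesis `8 * q ≤ 1` is what brings the Lipschitz constant `4 * q` down to `1 / 2`.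
  have contr : ContractingWith (1 / 2) (maps.restrict T _ _) := by
    refine ⟨by norm_num, LipschitzWith.of_dist_le_mul fun v w => ?_⟩
    have hv := mem_closedBall_zero_iff.mp v.2
    have hw := mem_closedBall_zero_iff.mp w.2
    rw [Subtype.dist_eq, Subtype.dist_eq, dist_eq_norm, dist_eq_norm]
    refine (lip hv hw).trans ?_
    gcongr
    simp
    linarith
  have h0 : ‖(0 : ℂ)‖ ≤ x / 2 := by simp; linarith
  obtain ⟨w, hw, hfix, -⟩ := contr.exists_fixedPoint' hcomplete maps
    (mem_closedBall_zero_iff.mpr h0) (edist_ne_top _ _)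
  rw [mem_closedBall_zero_iff] at hw
  have him := half_le_im hw
  have hfix' : M * kernelHat c γ (Complex.I * x + w) / (2 * (Complex.I * x) + w) = w := hfix
  refine ⟨Complex.I * x + w, ⟨offPoles_of_im_ne_zero (by linarith), ?_⟩, by linarith, ?_⟩
  · rw [div_eq_iff (den0 hw)] at hfix'
    rw [hfix']
    push_cast
    linear_combination (x : ℂ) ^ 2 * Complex.I_sq
  -- The first iterate is `T 0`. The error `T w - T 0` is at most `4 * q * ‖w‖`, and `‖w‖ ≤ 2 * q *
  -- x` makes it quadratic in `q`.
  · have e : Complex.I * x + w - Complex.I * x - M * kernelHat c γ (Complex.I * x)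
        / (2 * (Complex.I * x)) = T w - T 0 := by
      have h1 : T w = w := hfix
      have h2 : T 0 = M * kernelHat c γ (Complex.I * x) / (2 * (Complex.I * x)) := by simp [hT]
      rw [h1, h2]
      ring
    rw [e]
    have h1 := lip hw h0
    rw [sub_zero] at h1
    have h2 := bound hw
    rw [show T w = w from hfix] at h2
    calc _ ≤ 4 * q * ‖w‖ := h1
      _ ≤ 4 * q * (2 * q * x) := by gcongr
      _ = 8 * q ^ 2 * x := by ring

/-! ### Mellin integrals -/

open MeasureTheory in
-- The beta integral `B(s, 1 - s) = Γ(s) Γ(1 - s)` with the reflection formula; the next two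
-- integrals follow by `v = t / (1 - t)` and `v = u²`.
lemma integral_rpow_mul_one_sub_rpow {s : ℝ} (h0 : 0 < s) (h1 : s < 1) :
    ∫ t in Set.Ioo (0 : ℝ) 1, t ^ (s - 1) * (1 - t) ^ (-s) = Real.pi / Real.sin (Real.pi * s) := by
  have hb := Complex.Gamma_mul_Gamma_eq_betaIntegral (s := s) (t := ((1 - s : ℝ) : ℂ))
    (by simpa using h0) (by simpa using h1)
  rw [Complex.Gamma_ofReal, Complex.Gamma_ofReal, ← Complex.ofReal_mul,
    Real.Gamma_mul_Gamma_one_sub, ← Complex.ofReal_add, add_sub_cancel, Complex.ofReal_one,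
    Complex.Gamma_one, one_mul, Complex.betaIntegral, intervalIntegral.integral_of_le zero_le_one,
    integral_Ioc_eq_integral_Ioo] at hb
  rw [← Complex.ofReal_inj, hb, ← integral_complex_ofReal]
  refine setIntegral_congr_fun measurableSet_Ioo fun t ht => ?_
  have ht1 : 0 ≤ 1 - t := by linarith [ht.2]
  rw [Complex.ofReal_mul, Complex.ofReal_cpow ht.1.le, Complex.ofReal_cpow ht1]
  push_cast
  congr 2
  ring

open MeasureTheory in
lemma integral_rpow_div_one_add {s : ℝ} (h0 : 0 < s) (h1 : s < 1) :
    ∫ v in Set.Ioi (0 : ℝ), v ^ (s - 1) / (1 + v) = Real.pi / Real.sin (Real.pi * s) := by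
  have himg : (fun t : ℝ => t / (1 - t)) '' Set.Ioo 0 1 = Set.Ioi 0 := by
    ext v
    constructor
    · rintro ⟨t, ht, rfl⟩
      exact div_pos ht.1 (by linarith [ht.2])
    · intro hv
      have hv' : 0 < v := hv
      refine ⟨v / (1 + v), ⟨by positivity, by rw [div_lt_one (by positivity)]; linarith⟩, ?_⟩
      field_simp
      ring
  have hinj : Set.InjOn (fun t : ℝ => t / (1 - t)) (Set.Ioo 0 1) := by
    intro t ht u hu h
    have h1 : 1 - t ≠ 0 := by linarith [ht.2]
    have h2 : 1 - u ≠ 0 := by linarith [hu.2]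
    simp only at h
    rw [div_eq_div_iff h1 h2] at h
    linarith
  have hder : ∀ t ∈ Set.Ioo (0 : ℝ) 1, HasDerivWithinAt (fun t : ℝ => t / (1 - t))
      (1 / (1 - t) ^ 2) (Set.Ioo 0 1) t := by
    intro t ht
    have h1 : 1 - t ≠ 0 := by linarith [ht.2]
    have := (hasDerivAt_id t).div ((hasDerivAt_id t).const_sub 1) h1
    convert! this.hasDerivWithinAt using 1
    simp
  rw [← himg, integral_image_eq_integral_abs_deriv_smul measurableSet_Ioo hder hinj,
    ← integral_rpow_mul_one_sub_rpow h0 h1]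
  refine setIntegral_congr_fun measurableSet_Ioo fun t ht => ?_
  have h2 : 0 < 1 - t := by linarith [ht.2]
  have h3 := ht.1
  simp only [smul_eq_mul]
  rw [abs_of_pos (by positivity), Real.div_rpow h3.le h2.le, Real.rpow_sub_one h2.ne',
    Real.rpow_neg h2.le]
  have h4 := Real.rpow_pos_of_pos h2 s
  field_simp
  ring

lemma integral_rpow_div_one_add_sq {q : ℝ} (h0 : -1 < q) (h1 : q < 1) :
    ∫ u in Set.Ioi (0 : ℝ), u ^ q / (1 + u ^ 2)
      = Real.pi / 2 / Real.sin (Real.pi / 2 * (q + 1)) := by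
  have h := integral_rpow_div_one_add (s := (q + 1) / 2) (by linarith) (by linarith)
  rw [← MeasureTheory.integral_comp_rpow_Ioi_of_pos (p := 2) two_pos] at h
  have e : ∫ u in Set.Ioi (0 : ℝ), 2 * (u ^ q / (1 + u ^ 2))
      = Real.pi / Real.sin (Real.pi * ((q + 1) / 2)) := by
    rw [← h]
    refine MeasureTheory.setIntegral_congr_fun measurableSet_Ioi fun u hu => ?_
    have hu' : (0 : ℝ) < u := hu
    simp only [smul_eq_mul]
    rw [show (2 : ℝ) - 1 = 1 by norm_num, Real.rpow_one, ← Real.rpow_mul hu'.le,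
      Real.rpow_two, show q = 2 * ((q + 1) / 2 - 1) + 1 by ring, Real.rpow_add_one hu'.ne']
    ring_nf
  rw [MeasureTheory.integral_const_mul] at e
  rw [show Real.pi / 2 * (q + 1) = Real.pi * ((q + 1) / 2) by ring, div_right_comm, ← e]
  ring

lemma sin_half_pi_mul_pos {y : ℝ} (h0 : 0 < y) (h1 : y < 2) : 0 < Real.sin (Real.pi / 2 * y) :=
  Real.sin_pos_of_pos_of_lt_pi (by positivity) (by nlinarith [Real.pi_pos])

/-- A non-integrable function has integral `0` by convention, whereas the value already computed is
positive. -/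
lemma integrableOn_rpow_div_one_add_sq {q : ℝ} (h0 : -1 < q) (h1 : q < 1) :
    MeasureTheory.IntegrableOn (fun u : ℝ => u ^ q / (1 + u ^ 2)) (Set.Ioi 0) := by
  refine not_imp_comm.1 MeasureTheory.integral_undef ?_
  rw [integral_rpow_div_one_add_sq h0 h1]
  have := sin_half_pi_mul_pos (y := q + 1) (by linarith) (by linarith)
  have := Real.pi_pos
  positivity

/-- By the double-angle formula `D₁` is half the Mellin integral of `u^(-r) / (1 + u²)`. In the same
way `-D₂` is half that of `u^(1-r) / (1 + u²)`. -/
lemma D₁_eq {r : ℝ} (h0 : 0 < r) (h1 : r < 1) :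
    D₁ r = Real.pi / 2 / Real.sin (Real.pi / 2 * (-r + 1)) / 2 := by
  have e1 : Real.sin (Real.pi / 2 * (-r + 1)) = Real.cos (Real.pi / 2 * r) := by
    rw [← Real.sin_pi_div_two_sub]
    ring_nf
  have e2 : Real.cos (Real.pi / 2 * (r + 1)) = -Real.sin (Real.pi / 2 * r) := by
    rw [← Real.cos_add_pi_div_two]
    ring_nf
  have e3 : Real.sin (Real.pi * r)
      = 2 * Real.sin (Real.pi / 2 * r) * Real.cos (Real.pi / 2 * r) := by
    rw [← Real.sin_two_mul]
    ring_nf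
  have h2 := sin_half_pi_mul_pos (y := -r + 1) (by linarith) (by linarith)
  have h3 := sin_half_pi_mul_pos (y := r) h0 (by linarith)
  rw [e1] at h2
  rw [D₁, e1, e2, e3]
  generalize Real.sin (Real.pi / 2 * r) = S at *
  generalize Real.cos (Real.pi / 2 * r) = C at *
  field_simp

lemma D₂_eq {r : ℝ} (h0 : 0 < r) (h1 : r < 1) :
    D₂ r = -(Real.pi / 2 / Real.sin (Real.pi / 2 * (1 - r + 1)) / 2) := by
  have e1 : Real.sin (Real.pi / 2 * (1 - r + 1)) = Real.sin (Real.pi / 2 * r) := by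
    rw [← Real.sin_pi_sub]
    ring_nf
  have e2 : Real.sin (Real.pi / 2 * (r + 1)) = Real.cos (Real.pi / 2 * r) := by
    rw [← Real.sin_add_pi_div_two]
    ring_nf
  have e3 : Real.sin (Real.pi * r)
      = 2 * Real.sin (Real.pi / 2 * r) * Real.cos (Real.pi / 2 * r) := by
    rw [← Real.sin_two_mul]
    ring_nf
  have h2 := sin_half_pi_mul_pos (y := -r + 1) (by linarith) (by linarith)
  rw [show Real.sin (Real.pi / 2 * (-r + 1)) = Real.cos (Real.pi / 2 * r) by
    rw [← Real.sin_pi_div_two_sub]; ring_nf] at h2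
  have h3 := sin_half_pi_mul_pos (y := r) h0 (by linarith)
  rw [D₂, e1, e2, e3]
  generalize Real.sin (Real.pi / 2 * r) = S at *
  generalize Real.cos (Real.pi / 2 * r) = C at *
  field_simp

/-- `∫₀^∞ u^{-r} / (u + i) du` in terms of `D₁` and `D₂`. -/
lemma integral_rpow_div_add_I {r : ℝ} (h0 : 0 < r) (h1 : r < 1) :
    ∫ u in Set.Ioi (0 : ℝ), ((u ^ (-r) : ℝ) : ℂ) / ((u : ℂ) + Complex.I)
      = 2 * Complex.I * (-(D₁ r : ℂ) + Complex.I * (D₂ r : ℂ)) := by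
  have e : ∀ u ∈ Set.Ioi (0 : ℝ), ((u ^ (-r) : ℝ) : ℂ) / ((u : ℂ) + Complex.I)
      = ((u ^ (1 - r) / (1 + u ^ 2) : ℝ) : ℂ)
        - Complex.I * ((u ^ (-r) / (1 + u ^ 2) : ℝ) : ℂ) := by
    intro u hu
    have hu' : (0 : ℝ) < u := hu
    have h2 : (u : ℂ) + Complex.I ≠ 0 := fun h => by simpa using congrArg Complex.im h
    have h3 : (1 + (u : ℂ) ^ 2) ≠ 0 := by
      have : (1 + u ^ 2 : ℝ) ≠ 0 := by positivity
      exact_mod_cast this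
    rw [show 1 - r = -r + 1 by ring, Real.rpow_add_one hu'.ne']
    push_cast
    field_simp
    linear_combination ((u ^ (-r) : ℝ) : ℂ) * Complex.I_sq
  rw [MeasureTheory.setIntegral_congr_fun measurableSet_Ioi e, MeasureTheory.integral_sub,
    MeasureTheory.integral_const_mul, integral_complex_ofReal, integral_complex_ofReal,
    integral_rpow_div_one_add_sq (by linarith) (by linarith),
    integral_rpow_div_one_add_sq (by linarith) (by linarith), D₁_eq h0 h1, D₂_eq h0 h1]
  · push_cast
    linear_combination (Real.pi / 2 / Complex.sin (Real.pi / 2 * (1 - r + 1)) : ℂ) * Complex.I_sq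
  · exact (integrableOn_rpow_div_one_add_sq (by linarith) (by linarith)).ofReal
  · exact (integrableOn_rpow_div_one_add_sq (by linarith) (by linarith)).ofReal.const_mul _

/-- The continuous analogue `𝒜 t^{-α} / (ℬ t^β + i x)` of the terms of the kernel at `i x`. -/
def contTerm (𝒜 ℬ α β x t : ℝ) : ℂ :=
  ((𝒜 * t ^ (-α) : ℝ) : ℂ) / (((ℬ * t ^ β : ℝ) : ℂ) + Complex.I * x)

variable {𝒜 ℬ α β : ℝ}

lemma le_norm_add_I {x : ℝ} (y : ℝ) (hx : 0 < x) : x ≤ ‖(y : ℂ) + Complex.I * x‖ := by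
  have := Complex.abs_im_le_norm ((y : ℂ) + Complex.I * x)
  simpa [abs_of_pos hx] using this

lemma le_norm_add_I' {y : ℝ} (x : ℝ) (hy : 0 ≤ y) : y ≤ ‖(y : ℂ) + Complex.I * x‖ := by
  have := Complex.abs_re_le_norm ((y : ℂ) + Complex.I * x)
  simpa [abs_of_nonneg hy] using this

lemma add_I_ne_zero {x : ℝ} (y : ℝ) (hx : 0 < x) : (y : ℂ) + Complex.I * x ≠ 0 :=
  norm_pos_iff.mp (hx.trans_le (le_norm_add_I y hx))

/-- `∫₀^∞` of the continuous analogue. -/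
lemma integral_contTerm (hℬ : 0 < ℬ) (hβ : 0 < β) (h0 : 0 < rParam α β) (h1 : rParam α β < 1)
    {x : ℝ} (hx : 0 < x) :
    ∫ t in Set.Ioi (0 : ℝ), contTerm 𝒜 ℬ α β x t
      = ((𝒜 * ℬ ^ (rParam α β - 1) / β * x ^ (-rParam α β) : ℝ) : ℂ)
        * (2 * Complex.I * (-(D₁ (rParam α β) : ℂ) + Complex.I * (D₂ (rParam α β) : ℂ))) := by
  set r := rParam α β with hr
  -- With `y = t^β`, the part `t^(β-1)` is absorbed by the Jacobian and the rest becomes `y^(-r)`.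
  -- The scaling `y = (x / ℬ) u` then extracts the power of `x`.
  have hα : -α = (β - 1) + β * (-r) := by
    rw [hr, rParam]
    field_simp
    ring
  set g : ℝ → ℂ := fun y => ((𝒜 / β * y ^ (-r) : ℝ) : ℂ) / (((ℬ * y : ℝ) : ℂ) + Complex.I * x)
    with hg
  have hxB : 0 < x / ℬ := by positivity
  have s1 : ∫ t in Set.Ioi (0 : ℝ), contTerm 𝒜 ℬ α β x t = ∫ y in Set.Ioi (0 : ℝ), g y := by
    rw [← MeasureTheory.integral_comp_rpow_Ioi_of_pos (g := g) hβ]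
    refine MeasureTheory.setIntegral_congr_fun measurableSet_Ioi fun t ht => ?_
    have ht' : (0 : ℝ) < t := ht
    simp only [contTerm, hg, Complex.real_smul]
    rw [hα, Real.rpow_add ht', Real.rpow_mul ht'.le, ← mul_div_assoc, ← Complex.ofReal_mul]
    congr 2
    field_simp
  have s2 := MeasureTheory.integral_comp_mul_left_Ioi' g 0 hxB
  rw [mul_zero] at s2
  have e : ∀ u ∈ Set.Ioi (0 : ℝ), g (x / ℬ * u)
      = ((𝒜 / β * (x / ℬ) ^ (-r) / x : ℝ) : ℂ)
        * (((u ^ (-r) : ℝ) : ℂ) / ((u : ℂ) + Complex.I)) := by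
    intro u hu
    have hu' : (0 : ℝ) < u := hu
    have h2 : (u : ℂ) + Complex.I ≠ 0 := fun h => by simpa using congrArg Complex.im h
    have h3 : (x : ℂ) ≠ 0 := by exact_mod_cast hx.ne'
    simp only [hg]
    rw [Real.mul_rpow hxB.le hu'.le, show ℬ * (x / ℬ * u) = x * u by field_simp,
      show ((x * u : ℝ) : ℂ) + Complex.I * x = x * (u + Complex.I) by push_cast; ring]
    push_cast
    field_simp
  rw [s1, ← s2, MeasureTheory.setIntegral_congr_fun measurableSet_Ioi e,
    MeasureTheory.integral_const_mul, integral_rpow_div_add_I h0 h1, Complex.real_smul,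
    ← mul_assoc, ← Complex.ofReal_mul]
  congr 2
  rw [Real.div_rpow hx.le hℬ.le, Real.rpow_neg hℬ.le, Real.rpow_sub_one hℬ.ne']
  have := Real.rpow_pos_of_pos hℬ r
  field_simp

/-! ### Comparison of the kernel with an integral -/

/-- Mean value inequality. For `n ≥ 1` the ratio `s / n` lies in `[1, 2]` on the cell, which makes
`s^(p-1)` comparable with `n^(p-1)` for either sign of `p - 1`. -/
lemma exists_abs_rpow_sub_le (p : ℝ) : ∃ C : ℝ, 0 ≤ C ∧ ∀ n t : ℝ, 1 ≤ n → t ∈ Set.Icc n (n + 1) →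
    |t ^ p - n ^ p| ≤ C * n ^ (p - 1) := by
  refine ⟨|p| * 2 ^ |p - 1|, by positivity, fun n t hn ht => ?_⟩
  have hn0 : 0 < n := by linarith
  have hder : ∀ s ∈ Set.Icc n (n + 1),
      HasDerivWithinAt (fun s : ℝ => s ^ p) (p * s ^ (p - 1)) (Set.Icc n (n + 1)) s :=
    fun s hs => (Real.hasDerivAt_rpow_const (Or.inl (by linarith [hs.1]))).hasDerivWithinAt
  have hbound : ∀ s ∈ Set.Icc n (n + 1),
      ‖p * s ^ (p - 1)‖ ≤ |p| * 2 ^ |p - 1| * n ^ (p - 1) := by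
    intro s hs
    have hs0 : 0 < s := by linarith [hs.1]
    have h1 : 1 ≤ s / n := (one_le_div hn0).mpr hs.1
    have h2 : s / n ≤ 2 := by rw [div_le_iff₀ hn0]; linarith [hs.2]
    rw [norm_mul, Real.norm_eq_abs, Real.norm_of_nonneg (by positivity), mul_assoc]
    gcongr
    calc s ^ (p - 1) = (s / n) ^ (p - 1) * n ^ (p - 1) := by
          rw [← Real.mul_rpow (by positivity) hn0.le, div_mul_cancel₀ _ hn0.ne']
      _ ≤ (s / n) ^ |p - 1| * n ^ (p - 1) := by
          gcongr
          exact le_abs_self _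
      _ ≤ _ := by gcongr
  have := (convex_Icc n (n + 1)).norm_image_sub_le_of_norm_hasDerivWithin_le hder hbound
    (Set.left_mem_Icc.mpr (by linarith)) ht
  have h3 : ‖t - n‖ ≤ 1 := by
    rw [Real.norm_eq_abs, abs_le]
    constructor <;> linarith [ht.1, ht.2]
  refine this.trans ?_
  have h4 : 0 ≤ |p| * 2 ^ |p - 1| * n ^ (p - 1) := by positivity
  nlinarith

/-- Moving from the node `k + 1` to any `t` in its unit cell costs no more than the error already
present in the asymptotics, so terms can be compared with an integrand pointwise. -/
lemma ConditionOne.exists_c_bound (h : ConditionOne c γ 𝒜 ℬ α β) : ∃ C : ℝ, 0 ≤ C ∧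
    ∀ (k : ℕ) (t : ℝ), t ∈ Set.Icc ((k : ℝ) + 1) ((k : ℝ) + 1 + 1) →
      |c k - 𝒜 * t ^ (-α)| ≤ C * ((k : ℝ) + 1) ^ (-α - 1) := by
  obtain ⟨C₁, hC₁, h₁⟩ := bound_of_isBigO_nat_atTop h.c_asymp
  obtain ⟨C₂, hC₂, h₂⟩ := exists_abs_rpow_sub_le (-α)
  have := h.𝒜_pos
  refine ⟨C₁ + 𝒜 * C₂, by positivity, fun k t ht => ?_⟩
  have hk : (0 : ℝ) < k + 1 := by positivity
  have e1 := h₁ (x := k) (by positivity)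
  have e2 := h₂ _ t (by linarith [k.cast_nonneg (α := ℝ)]) ht
  rw [Real.norm_eq_abs, Real.norm_of_nonneg (by positivity), one_div, ← Real.rpow_neg hk.le,
    div_eq_mul_inv, ← Real.rpow_neg hk.le, neg_add'] at e1
  calc |c k - 𝒜 * t ^ (-α)|
      = |(c k - 𝒜 * ((k : ℝ) + 1) ^ (-α)) - 𝒜 * (t ^ (-α) - ((k : ℝ) + 1) ^ (-α))| := by ring_nf
    _ ≤ |c k - 𝒜 * ((k : ℝ) + 1) ^ (-α)| + 𝒜 * |t ^ (-α) - ((k : ℝ) + 1) ^ (-α)| := by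
        refine (abs_sub _ _).trans ?_
        rw [abs_mul 𝒜, abs_of_pos this]
    _ ≤ _ := by
        rw [add_mul, mul_assoc]
        gcongr

lemma ConditionOne.exists_γ_bound (h : ConditionOne c γ 𝒜 ℬ α β) : ∃ C : ℝ, 0 ≤ C ∧
    ∀ (k : ℕ) (t : ℝ), t ∈ Set.Icc ((k : ℝ) + 1) ((k : ℝ) + 1 + 1) →
      |γ k - ℬ * t ^ β| ≤ C * ((k : ℝ) + 1) ^ (β - 1) := by
  obtain ⟨C₁, hC₁, h₁⟩ := bound_of_isBigO_nat_atTop h.γ_asymp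
  obtain ⟨C₂, hC₂, h₂⟩ := exists_abs_rpow_sub_le β
  have := h.ℬ_pos
  refine ⟨C₁ + ℬ * C₂, by positivity, fun k t ht => ?_⟩
  have hk : (0 : ℝ) < k + 1 := by positivity
  have e1 := h₁ (x := k) (by positivity)
  have e2 := h₂ _ t (by linarith [k.cast_nonneg (α := ℝ)]) ht
  rw [Real.norm_eq_abs, Real.norm_of_nonneg (by positivity)] at e1
  calc |γ k - ℬ * t ^ β|
      = |(γ k - ℬ * ((k : ℝ) + 1) ^ β) - ℬ * (t ^ β - ((k : ℝ) + 1) ^ β)| := by ring_nf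
    _ ≤ |γ k - ℬ * ((k : ℝ) + 1) ^ β| + ℬ * |t ^ β - ((k : ℝ) + 1) ^ β| := by
        refine (abs_sub _ _).trans ?_
        rw [abs_mul ℬ, abs_of_pos this]
    _ ≤ _ := by
        rw [add_mul, mul_assoc]
        gcongr

/-- For large `k` the error is at most half the main term; the finitely many other `k` only lower
the constant, as `γ k > 0`. -/
lemma ConditionOne.exists_le_γ (h : ConditionOne c γ 𝒜 ℬ α β) (hK : IsExpKernel c γ) :
    ∃ g : ℝ, 0 < g ∧ ∀ k : ℕ, g * ((k : ℝ) + 1) ^ β ≤ γ k := by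
  have hℬ := h.ℬ_pos
  have hO : (fun k : ℕ => ((k : ℝ) + 1) ^ β) =O[atTop] γ := by
    obtain ⟨C₁, hC₁, h₁⟩ := bound_of_isBigO_nat_atTop h.γ_asymp
    refine IsBigO.of_bound (2 / ℬ) ?_
    filter_upwards [tendsto_natCast_atTop_atTop.eventually_ge_atTop (2 * C₁ / ℬ)] with k hk
    have hk0 : (0 : ℝ) < k + 1 := by positivity
    have e1 := h₁ (x := k) (by positivity)
    rw [Real.norm_eq_abs, Real.norm_of_nonneg (by positivity), Real.rpow_sub_one hk0.ne'] at e1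
    rw [Real.norm_of_nonneg (by positivity), Real.norm_of_nonneg (hK.γ_pos k).le]
    have e2 : C₁ / (k + 1) ≤ ℬ / 2 := by
      rw [div_le_iff₀ hℬ] at hk
      rw [div_le_iff₀ hk0]
      linarith
    have e3 : C₁ * (((k : ℝ) + 1) ^ β / (k + 1)) ≤ ℬ / 2 * ((k : ℝ) + 1) ^ β := by
      rw [mul_div_left_comm, mul_comm]
      gcongr
    rw [div_mul_eq_mul_div, le_div_iff₀ hℬ]
    linarith [(abs_le.mp e1).1]
  obtain ⟨C, hC, hb⟩ := bound_of_isBigO_nat_atTop hO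
  refine ⟨C⁻¹, by positivity, fun k => ?_⟩
  have := hb (x := k) (hK.γ_pos k).ne'
  rw [Real.norm_of_nonneg (by positivity), Real.norm_of_nonneg (hK.γ_pos k).le] at this
  rw [inv_mul_le_iff₀ hC]
  exact this

/-- In the error of the denominator, one factor `γ k ≥ g n^β` compensates `n^(β-1)` and the other is
at least `x`. Both errors are thus `n^(-α-1) / x`, summable over `n` because `α > 0`. -/
lemma ConditionOne.exists_term_bound (h : ConditionOne c γ 𝒜 ℬ α β) (hK : IsExpKernel c γ) :
    ∃ C : ℝ, 0 ≤ C ∧ ∀ (x : ℝ), 0 < x → ∀ (k : ℕ) (t : ℝ),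
      t ∈ Set.Icc ((k : ℝ) + 1) ((k : ℝ) + 1 + 1) →
      ‖(c k : ℂ) * res γ (Complex.I * x) k - contTerm 𝒜 ℬ α β x t‖
        ≤ C * ((k : ℝ) + 1) ^ (-α - 1) / x := by
  obtain ⟨C₁, hC₁, h₁⟩ := h.exists_c_bound
  obtain ⟨C₂, hC₂, h₂⟩ := h.exists_γ_bound
  obtain ⟨g, hg, hγ⟩ := h.exists_le_γ hK
  have hA := h.𝒜_pos
  have hB := h.ℬ_pos
  refine ⟨C₁ + 𝒜 * C₂ / g, by positivity, fun x hx k t ht => ?_⟩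
  have hk : (0 : ℝ) < k + 1 := by positivity
  have ht0 : 0 < t := hk.trans_le ht.1
  set n : ℝ := (k : ℝ) + 1 with hn
  have hγk : 0 < γ k := hK.γ_pos k
  have n1 := add_I_ne_zero (γ k) hx
  have n2 := add_I_ne_zero (ℬ * t ^ β) hx
  have e : (c k : ℂ) * res γ (Complex.I * x) k - contTerm 𝒜 ℬ α β x t
      = ((c k - 𝒜 * t ^ (-α) : ℝ) : ℂ) / (γ k + Complex.I * x)
        - ((𝒜 * t ^ (-α) : ℝ) : ℂ) * ((γ k - ℬ * t ^ β : ℝ) : ℂ)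
          / ((γ k + Complex.I * x) * (((ℬ * t ^ β : ℝ) : ℂ) + Complex.I * x)) := by
    rw [res, contTerm, add_comm (Complex.I * (x : ℂ)), Complex.ofReal_sub, Complex.ofReal_sub]
    field_simp
    ring
  rw [e]
  refine (norm_sub_le _ _).trans ?_
  rw [add_mul _ _ (n ^ (-α - 1)), add_div _ _ x]
  refine add_le_add ?_ ?_
  · rw [norm_div, Complex.norm_real, Real.norm_eq_abs]
    gcongr
    · exact h₁ k t ht
    · exact le_norm_add_I _ hx
  · rw [norm_div, norm_mul, norm_mul, Complex.norm_real, Complex.norm_real, Real.norm_eq_abs,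
      Real.norm_eq_abs, abs_of_pos (by positivity)]
    have ha : t ^ (-α) ≤ n ^ (-α) :=
      Real.rpow_le_rpow_of_nonpos hk ht.1 (by linarith [h.α_pos])
    calc 𝒜 * t ^ (-α) * |γ k - ℬ * t ^ β|
          / (‖(γ k : ℂ) + Complex.I * x‖ * ‖((ℬ * t ^ β : ℝ) : ℂ) + Complex.I * x‖)
        ≤ 𝒜 * n ^ (-α) * (C₂ * n ^ (β - 1)) / (g * n ^ β * x) := by
          gcongr
          · exact h₂ k t ht
          · exact (hγ k).trans (le_norm_add_I' x hγk.le)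
          · exact le_norm_add_I _ hx
      _ = 𝒜 * C₂ / g * n ^ (-α - 1) / x := by
          rw [Real.rpow_sub_one hk.ne', Real.rpow_sub_one hk.ne']
          field_simp

lemma contTerm_continuousOn (𝒜 ℬ α β : ℝ) {x : ℝ} (hx : 0 < x) :
    ContinuousOn (contTerm 𝒜 ℬ α β x) (Set.Ioi 0) := by
  have hr : ∀ p : ℝ, ContinuousOn (fun t : ℝ => t ^ p) (Set.Ioi 0) := fun p t ht =>
    (Real.continuousAt_rpow_const t p (Or.inl (ne_of_gt ht))).continuousWithinAt
  unfold contTerm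
  refine ContinuousOn.div ?_ ?_ fun t _ => add_I_ne_zero _ hx
  · exact Complex.continuous_ofReal.comp_continuousOn (continuousOn_const.mul (hr _))
  · exact (Complex.continuous_ofReal.comp_continuousOn
      (continuousOn_const.mul (hr _))).add continuousOn_const

open MeasureTheory in
lemma contTerm_integrableOn_Ioi (hA : 0 < 𝒜) (hB : 0 < ℬ) (hαβ : 1 < α + β) {x : ℝ}
    (hx : 0 < x) : IntegrableOn (contTerm 𝒜 ℬ α β x) (Set.Ioi 1) := by
  refine Integrable.mono' (g := fun t => 𝒜 / ℬ * t ^ (-(α + β)))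
    ((integrableOn_Ioi_rpow_of_lt (by linarith) one_pos).const_mul _)
    (((contTerm_continuousOn 𝒜 ℬ α β hx).mono fun t ht =>
      Set.mem_Ioi.mpr (one_pos.trans ht)).aestronglyMeasurable measurableSet_Ioi) ?_
  filter_upwards [ae_restrict_mem measurableSet_Ioi] with t ht
  have ht0 : 0 < t := one_pos.trans ht
  rw [contTerm, norm_div, Complex.norm_real, Real.norm_of_nonneg (by positivity)]
  calc _ ≤ 𝒜 * t ^ (-α) / (ℬ * t ^ β) := by
        gcongr
        exact le_norm_add_I' x (by positivity)
    _ = _ := by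
        rw [neg_add, Real.rpow_add ht0, Real.rpow_neg ht0.le β]
        field_simp

lemma norm_contTerm_le (hA : 0 < 𝒜) {x t : ℝ} (hx : 0 < x) (ht : 0 < t) :
    ‖contTerm 𝒜 ℬ α β x t‖ ≤ 𝒜 / x * t ^ (-α) := by
  rw [contTerm, norm_div, Complex.norm_real, Real.norm_of_nonneg (by positivity),
    div_mul_eq_mul_div]
  gcongr
  exact le_norm_add_I _ hx

open MeasureTheory in
lemma contTerm_integrableOn_Ioc (hA : 0 < 𝒜) (hα : α < 1) {x : ℝ}
    (hx : 0 < x) : IntegrableOn (contTerm 𝒜 ℬ α β x) (Set.Ioc 0 1) := by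
  have hi := (intervalIntegral.intervalIntegrable_rpow' (a := 0) (b := 1) (r := -α)
    (by linarith)).1
  refine Integrable.mono' (hi.const_mul (𝒜 / x))
    (((contTerm_continuousOn 𝒜 ℬ α β hx).mono fun t ht => ht.1).aestronglyMeasurable
      measurableSet_Ioc) ?_
  filter_upwards [ae_restrict_mem measurableSet_Ioc] with t ht
  exact norm_contTerm_le hA hx ht.1

open MeasureTheory in
-- Lets the integral start at `0` instead of `1` at the cost `O(1/x)`. The bound `t^(-α)` is
-- integrable at `0` only for `α < 1`, so the case `r = 1` is treated apart.
lemma norm_integral_contTerm_Ioc_le (hA : 0 < 𝒜) (hα : α < 1) {x : ℝ} (hx : 0 < x) :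
    ‖∫ t in Set.Ioc (0 : ℝ) 1, contTerm 𝒜 ℬ α β x t‖ ≤ 𝒜 / (1 - α) / x := by
  have hi := (intervalIntegral.intervalIntegrable_rpow' (a := 0) (b := 1) (r := -α)
    (by linarith)).1
  calc _ ≤ ∫ t in Set.Ioc (0 : ℝ) 1, 𝒜 / x * t ^ (-α) := by
        refine norm_integral_le_of_norm_le (hi.const_mul (𝒜 / x)) ?_
        filter_upwards [ae_restrict_mem measurableSet_Ioc] with t ht
        exact norm_contTerm_le hA hx ht.1
    _ = _ := by
        rw [integral_const_mul, ← intervalIntegral.integral_of_le zero_le_one,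
          integral_rpow (Or.inl (by linarith)), Real.one_rpow, Real.zero_rpow (by linarith)]
        have : 1 - α ≠ 0 := by linarith
        rw [show -α + 1 = 1 - α by ring]
        field_simp
        ring

/-- The kernel at `i x` is the integral of its continuous analogue, up to `O(1/x)`. -/
theorem ConditionOne.exists_kernelHat_sub_integral_le (h : ConditionOne c γ 𝒜 ℬ α β)
    (hK : Kernel c γ) : ∃ C : ℝ, ∀ x : ℝ, 0 < x →
      ‖kernelHat c γ (Complex.I * x) - ∫ t in Set.Ioi (1 : ℝ), contTerm 𝒜 ℬ α β x t‖ ≤ C / x := by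
  obtain ⟨C, hC, hb⟩ := h.exists_term_bound hK.toIsExpKernel
  have hsum : Summable fun k : ℕ => ((k : ℝ) + 1) ^ (-α - 1) := by
    have := (summable_nat_add_iff 1).mpr
      (Real.summable_nat_rpow (p := -α - 1).mpr (by linarith [h.α_pos]))
    refine this.congr fun k => by push_cast; rfl
  refine ⟨C * ∑' k : ℕ, ((k : ℝ) + 1) ^ (-α - 1), fun x hx => ?_⟩
  set f := contTerm 𝒜 ℬ α β x with hf
  have hint := contTerm_integrableOn_Ioi h.𝒜_pos h.ℬ_pos h.one_lt_add hx
  have hint' : ∀ k : ℕ, IntervalIntegrable f MeasureTheory.volume ((k : ℝ) + 1)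
      (((k + 1 : ℕ) : ℝ) + 1) := by
    intro k
    rw [intervalIntegrable_iff_integrableOn_Ioc_of_le (by push_cast; linarith)]
    refine hint.mono_set fun t ht => ?_
    have := k.cast_nonneg (α := ℝ)
    exact lt_of_le_of_lt (by linarith) ht.1
  have lim1 : Tendsto (fun N : ℕ => ∑ k ∈ Finset.range N, (c k : ℂ) * res γ (Complex.I * x) k)
      atTop (𝓝 (kernelHat c γ (Complex.I * x))) := by
    rw [kernelHat_eq]
    exact (hK.summable_res _).hasSum.tendsto_sum_nat
  have lim2 : Tendsto (fun N : ℕ => ∑ k ∈ Finset.range N, ∫ t in ((k : ℝ) + 1)..((k + 1 : ℕ) + 1),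
      f t) atTop (𝓝 (∫ t in Set.Ioi (1 : ℝ), f t)) := by
    have := MeasureTheory.intervalIntegral_tendsto_integral_Ioi 1 hint
      (tendsto_atTop_add_const_right _ (1 : ℝ) (tendsto_natCast_atTop_atTop (R := ℝ)))
    refine this.congr fun N => ?_
    rw [intervalIntegral.sum_integral_adjacent_intervals (a := fun k : ℕ => (k : ℝ) + 1)
      fun k _ => hint' k]
    simp [hf]
  refine le_of_tendsto (lim1.sub lim2).norm (Eventually.of_forall fun N => ?_)
  rw [← Finset.sum_sub_distrib]
  calc _ ≤ ∑ k ∈ Finset.range N, C * ((k : ℝ) + 1) ^ (-α - 1) / x := by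
        refine norm_sum_le_of_le _ fun k _ => ?_
        -- The cell has length one, so the term equals its own integral over it.
        have e : (c k : ℂ) * res γ (Complex.I * x) k
            - ∫ t in ((k : ℝ) + 1)..((k + 1 : ℕ) + 1), f t
            = ∫ t in ((k : ℝ) + 1)..((k + 1 : ℕ) + 1),
              ((c k : ℂ) * res γ (Complex.I * x) k - f t) := by
          rw [intervalIntegral.integral_sub (by simp) (hint' k),
            intervalIntegral.integral_const]
          push_cast
          simp
        rw [e]
        refine (intervalIntegral.norm_integral_le_of_norm_le_const
          (C := C * ((k : ℝ) + 1) ^ (-α - 1) / x) fun t ht => ?_).trans_eq ?_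
        · rw [Set.uIoc_of_le (by push_cast; linarith)] at ht
          exact hb x hx k t ⟨ht.1.le, ht.2.trans_eq (by push_cast; ring)⟩
        · push_cast
          simp
    _ = C / x * ∑ k ∈ Finset.range N, ((k : ℝ) + 1) ^ (-α - 1) := by
        rw [Finset.mul_sum]
        exact Finset.sum_congr rfl fun k _ => by ring
    _ ≤ C / x * ∑' k : ℕ, ((k : ℝ) + 1) ^ (-α - 1) := by
        gcongr
        exact hsum.sum_le_tsum _ fun k _ => by positivity
    _ = _ := by ring

/-- Asymptotics of the kernel on the imaginary axis for `r < 1`. -/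
theorem ConditionOne.exists_kernelHat_asymp (h : ConditionOne c γ 𝒜 ℬ α β) (hK : Kernel c γ)
    (hβ : 0 < β) (h1 : rParam α β < 1) : ∃ C : ℝ, ∀ x : ℝ, 0 < x →
      ‖kernelHat c γ (Complex.I * x)
        - ((𝒜 * ℬ ^ (rParam α β - 1) / β * x ^ (-rParam α β) : ℝ) : ℂ)
        * (2 * Complex.I * (-(D₁ (rParam α β) : ℂ) + Complex.I * (D₂ (rParam α β) : ℂ)))‖
      ≤ C / x := by
  obtain ⟨C, hC⟩ := h.exists_kernelHat_sub_integral_le hK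
  have h0 : 0 < rParam α β := div_pos (by linarith [h.one_lt_add]) hβ
  have hα : α < 1 := by
    rw [rParam, div_lt_one hβ] at h1
    linarith
  refine ⟨C + 𝒜 / (1 - α), fun x hx => ?_⟩
  rw [← integral_contTerm h.ℬ_pos hβ h0 h1 hx, ← Set.Ioc_union_Ioi_eq_Ioi zero_le_one,
    MeasureTheory.setIntegral_union (Set.Ioc_disjoint_Ioi le_rfl) measurableSet_Ioi
      (contTerm_integrableOn_Ioc h.𝒜_pos hα hx)
      (contTerm_integrableOn_Ioi h.𝒜_pos h.ℬ_pos h.one_lt_add hx), add_comm (∫ _ in _, _), ← sub_sub,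
    add_div]
  exact (norm_sub_le _ _).trans (add_le_add (hC x hx) (norm_integral_contTerm_Ioc_le h.𝒜_pos hα hx))

/-- `∫₁^∞` of the continuous analogue for `α = 1`. -/
lemma integral_contTerm_one (hA : 0 < 𝒜) (hB : 0 < ℬ) (hβ : 0 < β) {x : ℝ} (hx : 0 < x) :
    ∫ t in Set.Ioi (1 : ℝ), contTerm 𝒜 ℬ 1 β x t
      = 𝒜 / (β * (Complex.I * x)) * (Complex.log (ℬ + Complex.I * x) - Complex.log ℬ) := by
  have hx' : (x : ℂ) ≠ 0 := by exact_mod_cast hx.ne'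
  have hβ' : (β : ℂ) ≠ 0 := by exact_mod_cast hβ.ne'
  -- Multiplying numerator and denominator by `t^(-β)` turns the integrand into a multiple of a
  -- logarithmic derivative. The argument of the logarithm has real part `ℬ > 0`, hence stays in the
  -- slit plane.
  set F : ℝ → ℂ := fun t => -(𝒜 / (β * (Complex.I * x)))
    * Complex.log (ℬ + Complex.I * x * ((t ^ (-β) : ℝ) : ℂ)) with hF
  have hder : ∀ t ∈ Set.Ici (1 : ℝ), HasDerivAt F (contTerm 𝒜 ℬ 1 β x t) t := by
    intro t ht
    have ht0 : 0 < t := one_pos.trans_le ht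
    have h1 : HasDerivAt (fun t : ℝ => ((t ^ (-β) : ℝ) : ℂ)) ((-β * t ^ (-β - 1) : ℝ) : ℂ) t :=
      (Real.hasDerivAt_rpow_const (Or.inl ht0.ne')).ofReal_comp
    have h2 : (ℬ + Complex.I * x * ((t ^ (-β) : ℝ) : ℂ)) ∈ Complex.slitPlane :=
      Or.inl (by simpa using hB)
    have h3 := (((h1.const_mul (Complex.I * x)).const_add (ℬ : ℂ)).clog_real h2).const_mul
      (-(𝒜 / (β * (Complex.I * x)) : ℂ))
    convert! h3 using 1
    have h4 := add_I_ne_zero (ℬ * t ^ β) hx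
    have h5 := Complex.slitPlane_ne_zero h2
    have h6 : ((t ^ β : ℝ) : ℂ) ≠ 0 := by exact_mod_cast (Real.rpow_pos_of_pos ht0 β).ne'
    have h7 : (t : ℂ) ≠ 0 := by exact_mod_cast ht0.ne'
    have h8 : ((t ^ (-β) : ℝ) : ℂ) = ((t ^ β : ℝ) : ℂ)⁻¹ := by
      rw [Real.rpow_neg ht0.le, Complex.ofReal_inv]
    rw [contTerm, Real.rpow_sub_one ht0.ne', Real.rpow_neg_one]
    push_cast at h4 h5 ⊢
    rw [h8] at h5 ⊢
    have h9 : (ℬ : ℂ) * ((t ^ β : ℝ) : ℂ) + Complex.I * x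
        = ((t ^ β : ℝ) : ℂ) * (ℬ + Complex.I * x * ((t ^ β : ℝ) : ℂ)⁻¹) := by
      field_simp
    rw [h9]
    have h10 := Complex.I_ne_zero
    generalize (ℬ : ℂ) + Complex.I * x * ((t ^ β : ℝ) : ℂ)⁻¹ = D at *
    field_simp
  have hlim : Tendsto F atTop (𝓝 (-(𝒜 / (β * (Complex.I * x))) * Complex.log ℬ)) := by
    refine Tendsto.const_mul _ (Tendsto.clog ?_ (Or.inl (by simpa using hB)))
    have h1 := (Complex.continuous_ofReal.tendsto 0).comp (tendsto_rpow_neg_atTop hβ)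
    have h2 := (h1.const_mul (Complex.I * (x : ℂ))).const_add (ℬ : ℂ)
    simpa using h2
  rw [MeasureTheory.integral_Ioi_of_hasDerivAt_of_tendsto' hder
    (contTerm_integrableOn_Ioi hA hB (by linarith) hx) hlim]
  simp only [hF, Real.one_rpow, Complex.ofReal_one, mul_one]
  ring

/-- After extracting `x`, the factor `ℬ / x + i` has modulus between `1` and `ℬ + 1`. -/
lemma norm_log_add_I_sub_le (hB : 0 < ℬ) {x : ℝ} (hx : 1 ≤ x) :
    ‖Complex.log (ℬ + Complex.I * x) - Real.log x‖ ≤ Real.log (ℬ + 1) + Real.pi := by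
  have hx0 : 0 < x := by linarith
  have hx' : (x : ℂ) ≠ 0 := by exact_mod_cast hx0.ne'
  set w : ℂ := ((ℬ / x : ℝ) : ℂ) + Complex.I with hw
  have h1 : (1 : ℝ) ≤ ‖w‖ := by
    have := le_norm_add_I (ℬ / x) one_pos
    simpa [hw] using this
  have h2 : ‖w‖ ≤ ℬ + 1 := by
    refine (norm_add_le _ _).trans ?_
    rw [Complex.norm_real, Complex.norm_I, Real.norm_of_nonneg (by positivity)]
    gcongr
    exact div_le_self hB.le hx
  have e : (ℬ : ℂ) + Complex.I * x = x * w := by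
    rw [hw]
    push_cast
    field_simp
  rw [e, Complex.log_ofReal_mul hx0 (norm_pos_iff.mp (by linarith)), add_sub_cancel_left]
  refine (Complex.norm_le_abs_re_add_abs_im _).trans (add_le_add ?_ ?_)
  · rw [Complex.log_re, abs_of_nonneg (Real.log_nonneg h1)]
    exact Real.log_le_log (by linarith) h2
  · rw [Complex.log_im]
    exact Complex.abs_arg_le_pi w

/-- Asymptotics of the kernel on the imaginary axis for `r = 1`. -/
theorem ConditionOne.exists_kernelHat_asymp_log (h : ConditionOne c γ 𝒜 ℬ 1 β)
    (hK : Kernel c γ) (hβ : 0 < β) : ∃ C : ℝ, ∀ x : ℝ, 1 ≤ x →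
      ‖kernelHat c γ (Complex.I * x) - 𝒜 / (β * (Complex.I * x)) * Real.log x‖ ≤ C / x := by
  obtain ⟨C, hC⟩ := h.exists_kernelHat_sub_integral_le hK
  have hA := h.𝒜_pos
  refine ⟨C + 𝒜 / β * (Real.log (ℬ + 1) + Real.pi + ‖Complex.log ℬ‖), fun x hx => ?_⟩
  have hx0 : 0 < x := by linarith
  have h1 := hC x hx0
  rw [integral_contTerm_one hA h.ℬ_pos hβ hx0] at h1
  have h2 : ‖(𝒜 : ℂ) / (β * (Complex.I * x))‖ = 𝒜 / β / x := by
    rw [norm_div, norm_mul, norm_mul, Complex.norm_real, Complex.norm_real, Complex.norm_real,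
      Complex.norm_I, Real.norm_of_nonneg hA.le, Real.norm_of_nonneg hβ.le,
      Real.norm_of_nonneg hx0.le, one_mul, div_div]
  have e : kernelHat c γ (Complex.I * x) - 𝒜 / (β * (Complex.I * x)) * Real.log x
      = (kernelHat c γ (Complex.I * x) - 𝒜 / (β * (Complex.I * x))
          * (Complex.log (ℬ + Complex.I * x) - Complex.log ℬ))
        + 𝒜 / (β * (Complex.I * x)) * ((Complex.log (ℬ + Complex.I * x) - Real.log x)
          - Complex.log ℬ) := by ring
  rw [e]
  calc _ ≤ C / x + 𝒜 / β / x * (Real.log (ℬ + 1) + Real.pi + ‖Complex.log ℬ‖) := by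
        refine (norm_add_le _ _).trans (add_le_add h1 ?_)
        rw [norm_mul, h2]
        gcongr
        exact (norm_sub_le _ _).trans
          (add_le_add_left (norm_log_add_I_sub_le h.ℬ_pos hx) _)
    _ = _ := by ring

variable {θ : ℝ}

/-! ### Asymptotics of the non-real zeros -/

lemma ellZeros_eq {x : ℝ} (hx : 0 < x) :
    ellZeros c γ θ x = {z | IsZero c γ (x ^ 2) (x ^ 2 / x ^ (2 * (1 - θ))) z} := by
  have hX : ((x ^ (2 * (1 - θ)) : ℝ) : ℂ) ≠ 0 := by
    exact_mod_cast (Real.rpow_pos_of_pos hx _).ne'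
  ext z
  refine and_congr Iff.rfl ?_
  rw [ell, ← sub_eq_zero (b := ((x ^ 2 / x ^ (2 * (1 - θ)) : ℝ) : ℂ) * _)]
  push_cast
  rw [show (z ^ 2 + (x : ℂ) ^ 2 * (1 - 1 / ((x ^ (2 * (1 - θ)) : ℝ) : ℂ) * kernelHat c γ z))
    = z ^ 2 + (x : ℂ) ^ 2 - (x : ℂ) ^ 2 / ((x ^ (2 * (1 - θ)) : ℝ) : ℂ) * kernelHat c γ z by
      ring]

lemma one_le_rpow_two_mul (hθ : θ ≤ 1) {x : ℝ} (hx : 1 ≤ x) : 1 ≤ x ^ (2 * (1 - θ)) :=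
  Real.one_le_rpow hx (by linarith)

/-- The zero near `i x`, compared with the first step of the iteration. -/
lemma Kernel.exists_zero_near_of_absSum_le (hK : Kernel c γ) (hθ : θ ≤ 1) {x : ℝ} (hx : 1 ≤ x)
    (hS : 8 * absSum c γ x ≤ 1) {k : ℂ} {C : ℝ}
    (hk : ‖kernelHat c γ (Complex.I * x) - k‖ ≤ C / x) :
    ∃ z, IsZero c γ (x ^ 2) (x ^ 2 / x ^ (2 * (1 - θ))) z ∧ 0 < z.im ∧
      ‖z - (Complex.I * x + ((x ^ 2 / x ^ (2 * (1 - θ)) : ℝ) : ℂ) * k / (2 * (Complex.I * x)))‖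
        ≤ C * (1 / x ^ (2 * (1 - θ)))
          + 8 * (absSum c γ x ^ 2 * x / (x ^ (2 * (1 - θ))) ^ 2) := by
  have hx0 : 0 < x := by linarith
  have hX1 := one_le_rpow_two_mul hθ hx
  set X := x ^ (2 * (1 - θ)) with hX
  have hX0 : 0 < X := by linarith
  have hS0 := hK.absSum_nonneg x
  have e1 : x ^ 2 / X * absSum c γ x / x ^ 2 = absSum c γ x / X := by field_simp
  have hq : absSum c γ x / X ≤ absSum c γ x := div_le_self hS0 hX1
  obtain ⟨z, hz, him, hb⟩ := hK.exists_zero_near hx0 (M := x ^ 2 / X) (by positivity)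
    (by rw [e1]; linarith)
  refine ⟨z, hz, him, ?_⟩
  rw [e1] at hb
  have e2 : z - (Complex.I * x + ((x ^ 2 / X : ℝ) : ℂ) * k / (2 * (Complex.I * x)))
      = (z - Complex.I * x - ((x ^ 2 / X : ℝ) : ℂ) * kernelHat c γ (Complex.I * x)
          / (2 * (Complex.I * x)))
        + ((x ^ 2 / X : ℝ) : ℂ) / (2 * (Complex.I * x)) * (kernelHat c γ (Complex.I * x) - k) := by
    ring
  have e3 : ‖((x ^ 2 / X : ℝ) : ℂ) / (2 * (Complex.I * x))‖ = x / X / 2 := by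
    rw [norm_div, norm_mul, norm_mul, Complex.norm_real, Complex.norm_real, Complex.norm_I,
      Real.norm_of_nonneg hx0.le, Real.norm_of_nonneg (by positivity)]
    simp only [RCLike.norm_ofNat, one_mul]
    field_simp
  have hC : 0 ≤ C / x := (norm_nonneg _).trans hk
  rw [e2, add_comm]
  refine (norm_add_le _ _).trans (add_le_add ?_ (hb.trans_eq (by ring)))
  rw [norm_mul, e3]
  calc x / X / 2 * ‖kernelHat c γ (Complex.I * x) - k‖ ≤ x / X * (C / x) :=
        mul_le_mul (half_le_self (by positivity)) hk (norm_nonneg _) (by positivity)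
    _ = _ := by field_simp

/-- The leading term is the first iterate with the kernel replaced by its asymptotics. The exponent
`n₁` collects the powers of `x` in `M x^(-r) / x`. -/
lemma leadingTerm_one_eq (hβ : β ≠ 0) {x : ℝ} (hx : 0 < x) (r : ℝ) :
    leadingTerm 𝒜 ℬ β θ r 1 x
      = Complex.I * x + ((x ^ 2 / x ^ (2 * (1 - θ)) : ℝ) : ℂ)
        * (((𝒜 * ℬ ^ (r - 1) / β * x ^ (-r) : ℝ) : ℂ)
          * (2 * Complex.I * (-(D₁ r : ℂ) + Complex.I * (D₂ r : ℂ)))) / (2 * (Complex.I * x)) := by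
  have hx' : (x : ℂ) ≠ 0 := by exact_mod_cast hx.ne'
  have hβ' : (β : ℂ) ≠ 0 := by exact_mod_cast hβ
  have e : (x ^ n₁ θ r)⁻¹ = x ^ 2 / x ^ (2 * (1 - θ)) * x ^ (-r) / x := by
    rw [← Real.rpow_neg hx.le, ← Real.rpow_two, ← Real.rpow_sub hx, ← Real.rpow_add hx,
      ← Real.rpow_sub_one hx.ne', n₁]
    congr 1
    ring
  have e' : ∀ D : ℝ, 𝒜 * D * ℬ ^ (r - 1) / (β * x ^ n₁ θ r)
      = (x ^ 2 / x ^ (2 * (1 - θ))) * (𝒜 * ℬ ^ (r - 1) / β * x ^ (-r)) / x * D := by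
    intro D
    rw [div_mul_eq_div_div, div_eq_mul_inv _ (x ^ n₁ θ r), e]
    ring
  rw [leadingTerm, e', e']
  generalize x ^ 2 / x ^ (2 * (1 - θ)) = M
  generalize 𝒜 * ℬ ^ (r - 1) / β * x ^ (-r) = N
  have h10 := Complex.I_ne_zero
  push_cast
  field_simp
  ring

lemma leadingTermLog_one_eq (hβ : β ≠ 0) {x : ℝ} (hx : 0 < x) :
    leadingTermLog 𝒜 β θ 1 x
      = Complex.I * x + ((x ^ 2 / x ^ (2 * (1 - θ)) : ℝ) : ℂ)
        * (𝒜 / (β * (Complex.I * x)) * Real.log x) / (2 * (Complex.I * x)) := by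
  have hx' : (x : ℂ) ≠ 0 := by exact_mod_cast hx.ne'
  have hβ' : (β : ℂ) ≠ 0 := by exact_mod_cast hβ
  have hX : ((x ^ (2 * (1 - θ)) : ℝ) : ℂ) ≠ 0 := by
    exact_mod_cast (Real.rpow_pos_of_pos hx _).ne'
  have h10 := Complex.I_ne_zero
  rw [leadingTermLog]
  push_cast
  field_simp
  linear_combination (-(𝒜 * Real.log x : ℂ)) * Complex.I_sq

/-- Asymptotics of the zero near `i x` for `r < 1`. -/
theorem ConditionOne.exists_zero_asymp (h : ConditionOne c γ 𝒜 ℬ α β) (hK : Kernel c γ)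
    (hβ : 0 < β) (hθ : θ ≤ 1) (h1 : rParam α β < 1) : ∃ C : ℝ, 0 ≤ C ∧ ∀ᶠ x : ℝ in atTop,
      ∃ z, IsZero c γ (x ^ 2) (x ^ 2 / x ^ (2 * (1 - θ))) z ∧ 0 < z.im ∧
        ‖z - leadingTerm 𝒜 ℬ β θ (rParam α β) 1 x‖
          ≤ C * (1 / x ^ (2 * (1 - θ)) + 1 / x ^ (2 * rParam α β + 3 - 4 * θ)) := by
  have h0 : 0 < rParam α β := div_pos (by linarith [h.one_lt_add]) hβ
  obtain ⟨C, hC⟩ := h.exists_kernelHat_asymp hK hβ h1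
  set r := rParam α β with hr
  set L : ℝ := 𝒜 * ℬ ^ (r - 1) / β with hL
  set D : ℂ := 2 * Complex.I * (-(D₁ r : ℂ) + Complex.I * (D₂ r : ℂ)) with hD
  have hC0 : 0 ≤ C := by
    have := (norm_nonneg _).trans (hC 1 one_pos)
    simpa using this
  have hL0 : 0 < L := by
    have := h.𝒜_pos
    have := h.ℬ_pos
    positivity
  set C₁ := 2 * (C + L * ‖D‖) with hC₁
  -- The `O(1/x)` remainder is absorbed since `r < 1`; this decay makes the contraction condition
  -- hold for large `x`.
  have hS : ∀ x : ℝ, 1 ≤ x → absSum c γ x ≤ C₁ * x ^ (-r) := by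
    intro x hx
    have hx0 : 0 < x := by linarith
    have e1 : 1 / x ≤ x ^ (-r) := by
      rw [one_div, ← Real.rpow_neg_one]
      exact Real.rpow_le_rpow_of_exponent_le hx (by linarith)
    have e2 : ‖((L * x ^ (-r) : ℝ) : ℂ) * D‖ = L * x ^ (-r) * ‖D‖ := by
      rw [norm_mul, Complex.norm_real, Real.norm_of_nonneg (by positivity)]
    have e3 := norm_le_norm_add_norm_sub' (kernelHat c γ (Complex.I * x))
      (((L * x ^ (-r) : ℝ) : ℂ) * D)
    have e4 : C / x ≤ C * x ^ (-r) := by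
      rw [div_eq_mul_one_div]
      gcongr
    linarith [hK.absSum_le hx0, hC x hx0]
  have lim : Tendsto (fun x : ℝ => 8 * (C₁ * x ^ (-r))) atTop (𝓝 0) := by
    simpa using ((tendsto_rpow_neg_atTop h0).const_mul C₁).const_mul 8
  refine ⟨max C (8 * C₁ ^ 2), le_max_of_le_left hC0, ?_⟩
  filter_upwards [eventually_ge_atTop 1, lim.eventually_le_const one_pos] with x hx hxS
  have hx0 : 0 < x := by linarith
  obtain ⟨z, hz, him, hb⟩ := hK.exists_zero_near_of_absSum_le hθ hx
    (by linarith [hS x hx]) (hC x hx0)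
  refine ⟨z, hz, him, ?_⟩
  rw [leadingTerm_one_eq hβ.ne' hx0]
  refine hb.trans ?_
  rw [mul_add]
  refine add_le_add (by gcongr; exact le_max_left _ _) ?_
  -- The quadratic error of the iteration is the origin of the second exponent in `n₂`.
  have e5 : (x ^ (-r)) ^ 2 * x / (x ^ (2 * (1 - θ))) ^ 2 = 1 / x ^ (2 * r + 3 - 4 * θ) := by
    rw [one_div, ← Real.rpow_neg hx0.le, ← Real.rpow_natCast, ← Real.rpow_natCast,
      ← Real.rpow_mul hx0.le, ← Real.rpow_mul hx0.le, ← Real.rpow_add_one hx0.ne',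
      ← Real.rpow_sub hx0]
    congr 1
    push_cast
    ring
  have hS0 := hK.absSum_nonneg x
  calc 8 * (absSum c γ x ^ 2 * x / (x ^ (2 * (1 - θ))) ^ 2)
      ≤ 8 * ((C₁ * x ^ (-r)) ^ 2 * x / (x ^ (2 * (1 - θ))) ^ 2) := by
        gcongr
        exact hS x hx
    _ = 8 * C₁ ^ 2 * ((x ^ (-r)) ^ 2 * x / (x ^ (2 * (1 - θ))) ^ 2) := by ring
    _ ≤ _ := by
        rw [e5]
        gcongr
        exact le_max_right _ _

/-- A crude bound suffices for `r = 1`: if `absSum` is `O(x^(-1/2))`, its square times `x` is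
bounded, and the quadratic error is `O(1 / X²)` with `X = x^(2(1-θ)) ≥ 1`. -/
lemma one_add_log_le {x : ℝ} (hx : 0 < x) : 1 + Real.log x ≤ 2 * √x := by
  have h1 := Real.log_le_sub_one_of_pos (Real.sqrt_pos.mpr hx)
  rw [Real.log_sqrt hx.le] at h1
  linarith

/-- Asymptotics of the zero near `i x` for `r = 1`. -/
theorem ConditionOne.exists_zero_asymp_log (h : ConditionOne c γ 𝒜 ℬ 1 β) (hK : Kernel c γ)
    (hβ : 0 < β) (hθ : θ ≤ 1) : ∃ C : ℝ, ∀ᶠ x : ℝ in atTop,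
      ∃ z, IsZero c γ (x ^ 2) (x ^ 2 / x ^ (2 * (1 - θ))) z ∧ 0 < z.im ∧
        ‖z - leadingTermLog 𝒜 β θ 1 x‖ ≤ C * (1 / x ^ (2 * (1 - θ))) := by
  obtain ⟨C, hC⟩ := h.exists_kernelHat_asymp_log hK hβ
  have hA := h.𝒜_pos
  have hC0 : 0 ≤ C := by
    have := (norm_nonneg _).trans (hC 1 le_rfl)
    simpa using this
  set C₁ := 4 * (C + 𝒜 / β) with hC₁
  have hS : ∀ x : ℝ, 1 ≤ x → absSum c γ x ≤ C₁ * (√x / x) := by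
    intro x hx
    have hx0 : 0 < x := by linarith
    have hl := Real.log_nonneg hx
    have hl' := one_add_log_le hx0
    have e2 : ‖(𝒜 : ℂ) / (β * (Complex.I * x)) * Real.log x‖ = 𝒜 / β * (Real.log x / x) := by
      rw [norm_mul, norm_div, norm_mul, norm_mul, Complex.norm_real, Complex.norm_real,
        Complex.norm_real, Complex.norm_real, Complex.norm_I, Real.norm_of_nonneg hA.le,
        Real.norm_of_nonneg hβ.le, Real.norm_of_nonneg hx0.le, Real.norm_of_nonneg hl, one_mul]
      field_simp
    have e3 := norm_le_norm_add_norm_sub' (kernelHat c γ (Complex.I * x))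
      (𝒜 / (β * (Complex.I * x)) * Real.log x)
    have e4 : C / x ≤ C * (2 * √x / x) := by
      rw [div_eq_mul_one_div]
      gcongr
      linarith
    have e5 : 𝒜 / β * (Real.log x / x) ≤ 𝒜 / β * (2 * √x / x) := by
      gcongr
      linarith
    calc absSum c γ x ≤ 2 * (C * (2 * √x / x) + 𝒜 / β * (2 * √x / x)) := by
          linarith [hK.absSum_le hx0, hC x hx]
      _ = _ := by ring
  have lim : Tendsto (fun x : ℝ => 8 * (C₁ * (√x / x))) atTop (𝓝 0) := by
    have := (tendsto_inv_atTop_zero.comp Real.tendsto_sqrt_atTop).const_mul C₁ |>.const_mul 8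
    simpa [Real.sqrt_div_self] using this
  refine ⟨C + 8 * C₁ ^ 2, ?_⟩
  filter_upwards [eventually_ge_atTop 1, lim.eventually_le_const one_pos] with x hx hxS
  have hx0 : 0 < x := by linarith
  have hX1 := one_le_rpow_two_mul hθ hx
  obtain ⟨z, hz, him, hb⟩ := hK.exists_zero_near_of_absSum_le hθ hx
    (by linarith [hS x hx]) (hC x hx)
  refine ⟨z, hz, him, ?_⟩
  rw [leadingTermLog_one_eq hβ.ne' hx0]
  refine hb.trans ?_
  rw [add_mul]
  refine add_le_add le_rfl ?_
  have hS0 := hK.absSum_nonneg x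
  set X := x ^ (2 * (1 - θ)) with hX
  calc 8 * (absSum c γ x ^ 2 * x / X ^ 2) ≤ 8 * ((C₁ * (√x / x)) ^ 2 * x / X ^ 2) := by
        gcongr
        exact hS x hx
    _ = 8 * C₁ ^ 2 * (1 / X ^ 2) := by
        rw [mul_pow, div_pow, Real.sq_sqrt hx0.le]
        field_simp
    _ ≤ _ := by
        gcongr
        nlinarith

lemma leadingTerm_conj (𝒜 ℬ β θ r x : ℝ) : leadingTerm 𝒜 ℬ β θ r (-1) x
    = (starRingEnd ℂ) (leadingTerm 𝒜 ℬ β θ r 1 x) := by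
  simp only [leadingTerm, map_add, map_neg, map_mul, Complex.conj_ofReal, Complex.conj_I]
  push_cast
  ring

lemma leadingTermLog_conj (𝒜 β θ x : ℝ) : leadingTermLog 𝒜 β θ (-1) x
    = (starRingEnd ℂ) (leadingTermLog 𝒜 β θ 1 x) := by
  simp only [leadingTermLog, map_add, map_neg, map_mul, Complex.conj_ofReal, Complex.conj_I]
  push_cast
  ring

lemma HasZeroAsymptotics.conj {a : ℕ → ℝ} {r : ℝ} {p m : ℕ → ℂ}
    (h : HasZeroAsymptotics a 𝒜 ℬ β θ r 1 p) (hpm : ∀ᶠ n in atTop, m n = (starRingEnd ℂ) (p n)) :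
    HasZeroAsymptotics a 𝒜 ℬ β θ r (-1) m := by
  have key : ∀ {u : ℕ → ℂ} {v : ℕ → ℂ} {g : ℕ → ℝ}, (∀ n, v n = (starRingEnd ℂ) (u n)) →
      (fun n => p n - u n) =O[atTop] g → (fun n => m n - v n) =O[atTop] g := by
    intro u v g huv hO
    refine IsBigO.trans (IsBigO.of_bound 1 ?_) hO
    filter_upwards [hpm] with n hn
    rw [hn, huv, ← map_sub, RCLike.norm_conj, one_mul]
  exact ⟨fun h1 h2 h3 => key (fun n => leadingTerm_conj ..) (h.1 h1 h2 h3),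
    fun h1 h2 h3 => key (fun n => leadingTerm_conj ..) (h.2.1 h1 h2 h3),
    fun h1 => key (fun n => leadingTermLog_conj ..) (h.2.2 h1)⟩

/-- Since `p n` must equal every zero in the upper half-plane, the zero produced by the contraction
is `p n` itself. -/
lemma ConditionOne.hasZeroAsymptotics (h : ConditionOne c γ 𝒜 ℬ α β) (hK : Kernel c γ)
    (hβ : 0 < β) (hθ : θ ≤ 1) {a : ℕ → ℝ} (ha : Tendsto a atTop atTop) {p : ℕ → ℂ}
    (hp : ∀ n z, IsZero c γ (a n ^ 2) (a n ^ 2 / a n ^ (2 * (1 - θ))) z → 0 < z.im → p n = z) :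
    (∀ᶠ n in atTop, IsZero c γ (a n ^ 2) (a n ^ 2 / a n ^ (2 * (1 - θ))) (p n) ∧ 0 < (p n).im) ∧
      HasZeroAsymptotics a 𝒜 ℬ β θ (rParam α β) 1 p := by
  have hr : rParam α β ≤ 1 := by
    rw [rParam, div_le_one hβ]
    linarith [h.α_le_one]
  rcases hr.lt_or_eq with hr | hr
  · obtain ⟨C, hC0, hC⟩ := h.exists_zero_asymp hK hβ hθ hr
    have hev : ∀ᶠ n in atTop, (IsZero c γ (a n ^ 2) (a n ^ 2 / a n ^ (2 * (1 - θ))) (p n)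
        ∧ 0 < (p n).im) ∧ ‖p n - leadingTerm 𝒜 ℬ β θ (rParam α β) 1 (a n)‖
          ≤ C * (1 / a n ^ (2 * (1 - θ)) + 1 / a n ^ (2 * rParam α β + 3 - 4 * θ)) := by
      filter_upwards [ha.eventually hC] with n ⟨z, hz, him, hb⟩
      rw [hp n z hz him]
      exact ⟨⟨hz, him⟩, hb⟩
    have key : ∀ e : ℝ, e ≤ 2 * (1 - θ) → e ≤ 2 * rParam α β + 3 - 4 * θ →
        (fun n => p n - leadingTerm 𝒜 ℬ β θ (rParam α β) 1 (a n))
          =O[atTop] fun n => 1 / a n ^ e := by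
      intro e he1 he2
      refine IsBigO.of_bound (C * 2) ?_
      filter_upwards [hev, ha.eventually_ge_atTop 1] with n hn hn1
      have hn0 : 0 < a n := by linarith
      have mono : ∀ {e' : ℝ}, e ≤ e' → 1 / a n ^ e' ≤ 1 / a n ^ e := fun he' =>
        one_div_le_one_div_of_le (by positivity) (Real.rpow_le_rpow_of_exponent_le hn1 he')
      rw [Real.norm_of_nonneg (by positivity), mul_assoc]
      refine hn.2.trans ?_
      gcongr
      linarith [mono he1, mono he2]
    refine ⟨hev.mono fun n hn => hn.1, fun _ _ _ => key _ (min_le_left _ _) (min_le_right _ _),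
      fun h0 _ h3 => key _ le_rfl ?_, fun h1 => absurd h1 hr.ne⟩
    -- What is needed is `2θ ≤ 2r + 1`; then `2(1 - θ)` is the smaller exponent.
    rcases h3 with h3 | h3 <;> linarith
  · have hα : α = 1 := by
      rw [rParam, div_eq_one_iff_eq hβ.ne'] at hr
      linarith
    subst hα
    obtain ⟨C, hC⟩ := h.exists_zero_asymp_log hK hβ hθ
    have hev : ∀ᶠ n in atTop, (IsZero c γ (a n ^ 2) (a n ^ 2 / a n ^ (2 * (1 - θ))) (p n)
        ∧ 0 < (p n).im) ∧ ‖p n - leadingTermLog 𝒜 β θ 1 (a n)‖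
          ≤ C * (1 / a n ^ (2 * (1 - θ))) := by
      filter_upwards [ha.eventually hC] with n ⟨z, hz, him, hb⟩
      rw [hp n z hz him]
      exact ⟨⟨hz, him⟩, hb⟩
    refine ⟨hev.mono fun n hn => hn.1, fun _ h2 _ => absurd hr (by linarith),
      fun _ h2 _ => absurd hr h2.ne, fun _ => IsBigO.of_bound C ?_⟩
    filter_upwards [hev, ha.eventually_gt_atTop 0] with n hn hn0
    rw [Real.norm_of_nonneg (by positivity)]
    exact hn.2

end GurtinPipkin

end

/-! ### Assembly of the theorem. -/

theorem mainTheorem5 (c γ a : ℕ → ℝ) (𝒜 ℬ α β θ : ℝ)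
    (hK : GurtinPipkin.IsExpKernel c γ)
    (ha : GurtinPipkin.IsEigenvalueSeq a)
    (hθ : θ ∈ Set.Icc (0 : ℝ) 1)
    (hβ : 1 / 2 < β)
    (h1 : GurtinPipkin.ConditionOne c γ 𝒜 ℬ α β)
    (hA : GurtinPipkin.ConditionA c γ) :
    ∃ (lam : ℕ → ℕ → ℝ) (lamPlus lamMinus : ℕ → ℂ),
      (∀ n, GurtinPipkin.ellZeros c γ θ (a n)
        = Set.range (fun k => (lam n k : ℂ)) ∪ {lamPlus n, lamMinus n}) ∧
      (∀ n, -γ 0 < lam n 0 ∧ lam n 0 < 0) ∧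
      (∀ n k, -γ (k + 1) < lam n (k + 1) ∧ lam n (k + 1) < -γ k) ∧
      (θ < 1 → ∀ k, Tendsto (fun n => lam n k) atTop (𝓝 (-γ k))) ∧
      (∀ᶠ n in atTop, (lamPlus n).im ≠ 0 ∧ (lamMinus n).im ≠ 0 ∧
        lamPlus n = (starRingEnd ℂ) (lamMinus n)) ∧
      GurtinPipkin.HasZeroAsymptotics a 𝒜 ℬ β θ (GurtinPipkin.rParam α β) 1 lamPlus ∧
      GurtinPipkin.HasZeroAsymptotics a 𝒜 ℬ β θ (GurtinPipkin.rParam α β) (-1) lamMinus := by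
  have hβ0 : 0 < β := by linarith
  have hker : GurtinPipkin.Kernel c γ := ⟨hK, hA.1⟩
  have ha1 : ∀ n, 1 ≤ a n := fun n => ha.one_le.trans (ha.mono n.zero_le)
  have ha0 : ∀ n, 0 < a n := fun n => one_pos.trans_le (ha1 n)
  have hX1 : ∀ n, 1 ≤ a n ^ (2 * (1 - θ)) := fun n =>
    GurtinPipkin.one_le_rpow_two_mul hθ.2 (ha1 n)
  have hM : ∀ n, 0 < a n ^ 2 / a n ^ (2 * (1 - θ)) := fun n =>
    div_pos (pow_pos (ha0 n) 2) (one_pos.trans_le (hX1 n))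
  have hb : ∀ n, a n ^ 2 / a n ^ (2 * (1 - θ)) * GurtinPipkin.kernelReal c γ 0 < a n ^ 2 := by
    intro n
    -- The condition `∑ c_k / γ_k < 1` says `K(0) < 1`, and `a n ≥ 1` with `θ ≤ 1` gives `M ≤ b`.
    have h2 : GurtinPipkin.kernelReal c γ 0 < 1 := by simpa [GurtinPipkin.kernelReal] using hA.2
    have h3 : a n ^ 2 / a n ^ (2 * (1 - θ)) ≤ a n ^ 2 := div_le_self (sq_nonneg _) (hX1 n)
    nlinarith [hM n]
  choose lam p m hset hgap huniq using fun n => hker.exists_zeros (hM n) (hb n)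
  have hzero : ∀ n k, GurtinPipkin.IsZero c γ (a n ^ 2) (a n ^ 2 / a n ^ (2 * (1 - θ)))
      (lam n k) := by
    intro n k
    have : (lam n k : ℂ) ∈ {z | GurtinPipkin.IsZero c γ (a n ^ 2)
        (a n ^ 2 / a n ^ (2 * (1 - θ))) z} := by
      rw [hset n]
      exact Or.inl ⟨k, rfl⟩
    exact this
  obtain ⟨hev, hasy⟩ := h1.hasZeroAsymptotics hker hβ0 hθ.2 ha.tendsto
    (fun n z hz him => (huniq n z hz him).1)
  have hconj : ∀ᶠ n in atTop, m n = (starRingEnd ℂ) (p n) :=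
    hev.mono fun n hn => (huniq n _ hn.1 hn.2).2
  refine ⟨lam, p, m, fun n => (GurtinPipkin.ellZeros_eq (ha0 n)).trans (hset n),
    fun n => ⟨(hgap n 0).1, hker.zero_neg (hM n) (hb n) (hzero n 0)⟩, fun n k => ?_,
    fun hθ1 k => ?_, ?_, hasy, hasy.conj hconj⟩
  · have := hgap n (k + 1)
    rwa [GurtinPipkin.gap_succ hK] at this
  · refine hker.tendsto_zero_of_mem_gap hM ?_ (fun n => hgap n k) (fun n => hzero n k)
    -- The ratio `b / M` is `a n ^ (2 * (1 - θ))`, which tends to infinity because `θ < 1`.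
    have h2 : Tendsto (fun n => a n ^ (2 * (1 - θ))) atTop atTop :=
      (tendsto_rpow_atTop (by linarith)).comp ha.tendsto
    refine h2.congr fun n => ?_
    exact (div_div_cancel₀ (pow_pos (ha0 n) 2).ne').symm
  · filter_upwards [hev, hconj] with n hn hmn
    rw [hmn, Complex.conj_conj, Complex.conj_im]
    exact ⟨hn.2.ne', neg_ne_zero.mpr hn.2.ne', rfl⟩
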